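/- Let $\rho>0$ and $\alpha>2$. For each $n\ge 2$ let $K_n$ be the complete graph on the vertex set $\{1,\dots,n\}$, and let its edges carry independent weights $X_e$, each with the law of $e^{-(E/\rho)^{1/\alpha}}$, where $E$ is an exponential random variable with mean one; let $F$ be the distribution function of this law. The weight of a path is the sum of the weights of its edges. Let $W_n$ be the minimal weight of a self-avoiding path in $K_n$ between the vertices $1$ and $2$; almost surely there is exactly one path attaining this minimum, and $H_n$ denotes its number of edges. Then, for every $n\ge 2$, the unique $u_n>0$ with $nF(u_n)=1$ is $$u_n=e^{-(\log n/\rho)^{1/\alpha}},$$ and, with $s_n=\dfrac{(\log n)^{-1+1/\alpha}}{\alpha\rho^{1/\alpha}}$, as $n\to\infty$, $$\frac{W_n}{u_n s_n\log n}\to e\quad\text{in probability}\qquad\text{and}\qquad \frac{H_n}{s_n\log n}\to 1\quad\text{in probability}.$$ -/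

import Mathlib

open MeasureTheory ProbabilityTheory Filter Topology

namespace CompleteFPP

/-- The total weight of a path, when the edge `e` has weight `x e`. -/
def pathWeight {V : Type*} {G : SimpleGraph V} (x : Sym2 V → ℝ) {a b : V} (p : G.Path a b) : ℝ :=
  ((p : G.Walk a b).edges.map x).sum

/-- The self-avoiding path `p` has minimal weight among all self-avoiding paths with its ends. -/
def IsOptimal {V : Type*} {G : SimpleGraph V} (x : Sym2 V → ℝ) {a b : V} (p : G.Path a b) : Prop :=
  ∀ q : G.Path a b, pathWeight x p ≤ pathWeight x q

/-- The first of the two marked vertices of the complete graph on `n ≥ 2` vertices. -/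
def vertexOne {n : ℕ} (hn : 2 ≤ n) : Fin n := ⟨0, by omega⟩

/-- The second of the two marked vertices of the complete graph on `n ≥ 2` vertices. -/
def vertexTwo {n : ℕ} (hn : 2 ≤ n) : Fin n := ⟨1, by omega⟩

/-- The self-avoiding paths in the complete graph on `n ≥ 2` vertices between the two marked
vertices. -/
abbrev MarkedPath {n : ℕ} (hn : 2 ≤ n) : Type :=
  (⊤ : SimpleGraph (Fin n)).Path (vertexOne hn) (vertexTwo hn)

/-- `W_n`: the minimal weight of a self-avoiding path between the two marked vertices of the
complete graph on `n` vertices (set to `0` for `n < 2`, where there are no two vertices). -/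
noncomputable def optimalWeight (n : ℕ) (x : Sym2 (Fin n) → ℝ) : ℝ :=
  if hn : 2 ≤ n then ⨅ p : MarkedPath hn, pathWeight x p else 0

/-- `H_n`: the number of edges of the optimal path between the two marked vertices of the complete
graph on `n` vertices. If several paths are optimal, the smallest number of edges is taken
(set to `0` for `n < 2`). -/
noncomputable def hopcount (n : ℕ) (x : Sym2 (Fin n) → ℝ) : ℕ :=
  if hn : 2 ≤ n then
    sInf {k : ℕ | ∃ p : MarkedPath hn,
      IsOptimal x p ∧ p.1.length = k}
  else 0

/-- The law of `exp (-(E / ρ) ^ (1 / α))`, where `E` is exponential with mean one. -/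
noncomputable def edgeLaw (ρ α : ℝ) : Measure ℝ :=
  (expMeasure 1).map (fun t => Real.exp (-(t / ρ) ^ (1 / α)))

/-- `u` is a positive number with `n F(u) = 1`, where `F` is the distribution function of `μ`. -/
def IsExtremeScale (μ : Measure ℝ) (n : ℕ) (u : ℝ) : Prop :=
  0 < u ∧ (n : ℝ) * cdf μ u = 1

/-- The sequence `u_n = exp (-(log n / ρ) ^ (1 / α))`. -/
noncomputable def uSeq (ρ α : ℝ) (n : ℕ) : ℝ :=
  Real.exp (-(Real.log n / ρ) ^ (1 / α))

/-- The sequence `s_n = (log n) ^ (-1 + 1 / α) / (α ρ ^ (1 / α))`. -/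
noncomputable def sSeq (ρ α : ℝ) (n : ℕ) : ℝ :=
  Real.log n ^ (-1 + 1 / α) / (α * ρ ^ (1 / α))

end CompleteFPP

/-! Put L = log n and κ = s_n L (`hopScale`), so that the claims read W_n / (u_n κ) → e and H_n / κ
→ 1. At the scale u_n the edge law looks like F(x) ≈ (x / u_n)^(1/s_n) / n. Since 1/s_n is large, a
light path does best with nearly equal weights. There are about n^(k-1) paths with k = hκ edges, so
the expected number of weight at most c u_n κ is exp(L (h log(c/h) - 1)) to leading order. The
function h ↦ h log(c/h) has maximum c/e, attained at h = c/e. For c < e no path is expected, and for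
c slightly above e only lengths with h near 1 survive.

The first-moment half is a Markov bound on negative powers of the weights: AM-GM
(`one_le_mul_prod_rpow_neg`) passes from the sum to a product, whose factors have moments controlled
by concavity (`lintegral_rpow_edgeLaw_le`). Summing over lengths gives `measure_exists_path_le`; its
error is negligible because s_n log L → 0.

Existence of a path of weight (e + o(1)) u_n κ comes from the second moment method on paths crossing
⌈κ⌉ disjoint layers of vertices with every edge at most e^(1+θ) u_n. Layers make overlaps easy to
count (`card_inter_layerEdge_le`). Both halves together locate W_n, and also H_n, since a path with
h away from 1 is too heavy to be optimal. -/

namespace CompleteFPP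

/-! ### The exponential law: tails and exponential moments. -/

section ExponentialLaw

open Set

lemma expMeasure_ae_nonneg : ∀ᵐ t ∂(expMeasure 1), (0 : ℝ) ≤ t := by
  have : IsProbabilityMeasure (expMeasure 1) := isProbabilityMeasure_expMeasure one_pos
  have h : (expMeasure 1) (Iio 0) = 0 := by
    rw [expMeasure, gammaMeasure, withDensity_apply _ measurableSet_Iio]
    exact lintegral_gammaPDF_of_nonpos le_rfl
  rw [ae_iff]
  simpa [Iio] using h

lemma expMeasure_Ici {x : ℝ} (hx : 0 ≤ x) :
    (expMeasure 1) (Ici x) = ENNReal.ofReal (Real.exp (-x)) := by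
  have : IsProbabilityMeasure (expMeasure 1) := isProbabilityMeasure_expMeasure one_pos
  have h0 : (expMeasure 1) {x} = 0 := by
    rw [expMeasure, gammaMeasure]
    exact withDensity_absolutelyContinuous _ _ (by simp)
  have h1 : (expMeasure 1) (Ici x) = (expMeasure 1) (Ioi x) :=
    measure_congr (by
      refine (Ioi_ae_eq_Ici' h0).symm)
  have h2 := cdf_expMeasure_eq one_pos x
  rw [cdf_eq_real, if_pos hx, one_mul] at h2
  have h3 : (expMeasure 1).real (Ioi x) = Real.exp (-x) := by
    rw [← compl_Iic, probReal_compl_eq_one_sub measurableSet_Iic, h2]; ring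
  rw [h1, ← h3, ofReal_measureReal]

lemma lintegral_exp_mul_expMeasure {q : ℝ} (hq : q < 1) :
    ∫⁻ t, ENNReal.ofReal (Real.exp (q * t)) ∂(expMeasure 1) = ENNReal.ofReal (1 / (1 - q)) := by
  have hq' : 0 < 1 - q := by linarith
  rw [expMeasure, gammaMeasure, lintegral_withDensity_eq_lintegral_mul _
    (by exact (measurable_gammaPDFReal 1 1).ennreal_ofReal) (by fun_prop)]
  have : ∀ t, (gammaPDF 1 1 * fun t => ENNReal.ofReal (Real.exp (q * t))) t =
      ENNReal.ofReal (1 / (1 - q)) * exponentialPDF (1 - q) t := by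
    intro t
    have e : gammaPDF 1 1 t = exponentialPDF 1 t := rfl
    rw [Pi.mul_apply, e, exponentialPDF_eq, exponentialPDF_eq,
      ← ENNReal.ofReal_mul (by split_ifs <;> positivity), ← ENNReal.ofReal_mul (by positivity)]
    congr 1
    split_ifs
    · rw [one_mul, one_mul, ← Real.exp_add]
      field_simp
      congr 1
      ring
    · simp
  simp_rw [this]
  rw [lintegral_const_mul _ (by exact (measurable_exponentialPDFReal _).ennreal_ofReal),
    lintegral_exponentialPDF_eq_one hq', mul_one]

end ExponentialLaw

/-! ### The edge law: quantiles, absence of atoms, negative moments. -/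

section EdgeLaw

open Set

variable {ρ α : ℝ}

lemma measurable_edgeMap : Measurable (fun t : ℝ => Real.exp (-(t / ρ) ^ (1 / α))) := by
  fun_prop

instance : IsProbabilityMeasure (edgeLaw ρ α) := by
  have : IsProbabilityMeasure (expMeasure 1) := isProbabilityMeasure_expMeasure one_pos
  exact Measure.isProbabilityMeasure_map measurable_edgeMap.aemeasurable

lemma edgeLaw_ae_pos : ∀ᵐ x ∂(edgeLaw ρ α), 0 < x := by
  rw [edgeLaw, ae_map_iff measurable_edgeMap.aemeasurable measurableSet_Ioi]
  exact ae_of_all _ fun t => Real.exp_pos _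

lemma edgeLaw_Iic_of_le_one (hρ : 0 < ρ) (hα : 0 < α) {u : ℝ} (hu : 0 < u) (hu1 : u ≤ 1) :
    edgeLaw ρ α (Iic u) = ENNReal.ofReal (Real.exp (-(ρ * (-Real.log u) ^ α))) := by
  have hl : 0 ≤ -Real.log u := by have := Real.log_nonpos hu.le hu1; linarith
  rw [edgeLaw, Measure.map_apply measurable_edgeMap measurableSet_Iic,
    ← expMeasure_Ici (by positivity)]
  apply measure_congr
  filter_upwards [expMeasure_ae_nonneg] with t ht
  apply propext
  change Real.exp (-(t / ρ) ^ (1 / α)) ≤ u ↔ ρ * (-Real.log u) ^ α ≤ t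
  rw [← Real.le_log_iff_exp_le hu, neg_le, one_div,
    Real.le_rpow_inv_iff_of_pos hl (by positivity) hα, le_div_iff₀ hρ, mul_comm]

lemma cdf_edgeLaw_of_le_one (hρ : 0 < ρ) (hα : 0 < α) {u : ℝ} (hu : 0 < u) (hu1 : u ≤ 1) :
    cdf (edgeLaw ρ α) u = Real.exp (-(ρ * (-Real.log u) ^ α)) := by
  rw [cdf_eq_real, measureReal_def, edgeLaw_Iic_of_le_one hρ hα hu hu1,
    ENNReal.toReal_ofReal (Real.exp_pos _).le]

lemma isExtremeScale_edgeLaw_iff (hρ : 0 < ρ) (hα : 0 < α) {n : ℕ} (hn : 2 ≤ n) (u : ℝ) :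
    IsExtremeScale (edgeLaw ρ α) n u ↔ u = uSeq ρ α n := by
  have hn1 : (1 : ℝ) < n := by exact_mod_cast hn
  have hL : 0 < Real.log n := Real.log_pos hn1
  have key : ∀ u : ℝ, 0 < u → u ≤ 1 →
      ((n : ℝ) * cdf (edgeLaw ρ α) u = 1 ↔ u = uSeq ρ α n) := by
    intro u hu hu1
    have hl : 0 ≤ -Real.log u := by have := Real.log_nonpos hu.le hu1; linarith
    rw [cdf_edgeLaw_of_le_one hρ hα hu hu1, uSeq]
    have e1 : (n : ℝ) * Real.exp (-(ρ * (-Real.log u) ^ α)) = 1 ↔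
        (-Real.log u) ^ α = Real.log n / ρ := by
      rw [Real.exp_neg, ← div_eq_mul_inv, div_eq_one_iff_eq (Real.exp_ne_zero _),
        eq_div_iff hρ.ne']
      constructor
      · intro h; rw [h, Real.log_exp]; ring
      · intro h; rw [mul_comm ρ, h, Real.exp_log (by linarith)]
    rw [e1, ← Real.eq_rpow_inv hl (by positivity) hα.ne', ← one_div, neg_eq_iff_eq_neg]
    constructor
    · intro h; rw [← h, Real.exp_log hu]
    · intro h; rw [h, Real.log_exp]
  constructor
  · rintro ⟨hu, h⟩
    rcases le_or_gt u 1 with hu1 | hu1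
    · exact (key u hu hu1).1 h
    · have h1 : cdf (edgeLaw ρ α) 1 = 1 := by
        rw [cdf_edgeLaw_of_le_one hρ hα one_pos le_rfl]
        simp [Real.zero_rpow hα.ne']
      have h2 : 1 ≤ cdf (edgeLaw ρ α) u := h1 ▸ monotone_cdf _ hu1.le
      nlinarith
  · rintro rfl
    have h1 : 0 < uSeq ρ α n := Real.exp_pos _
    refine ⟨h1, (key _ h1 ?_).2 rfl⟩
    rw [uSeq, Real.exp_le_one_iff, neg_nonpos]
    positivity

lemma nullSingletonClass_edgeLaw (hρ : 0 < ρ) (hα : 0 < α) : NullSingletonClass (edgeLaw ρ α) := by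
  refine ⟨fun x => ?_⟩
  rw [edgeLaw, Measure.map_apply measurable_edgeMap (measurableSet_singleton x)]
  have hs : ((fun t : ℝ => Real.exp (-(t / ρ) ^ (1 / α))) ⁻¹' {x} ∩ Ici 0).Subsingleton := by
    rintro t ⟨ht, ht0⟩ t' ⟨ht', ht0'⟩
    have h : Real.exp (-(t / ρ) ^ (1 / α)) = Real.exp (-(t' / ρ) ^ (1 / α)) := by
      rw [mem_preimage, mem_singleton_iff] at ht ht'
      rw [ht, ht']
    have h' := neg_injective (Real.exp_injective h)
    have ht0 : 0 ≤ t := ht0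
    have ht0' : 0 ≤ t' := ht0'
    rw [one_div, Real.rpow_left_inj (by positivity) (by positivity) (by positivity)] at h'
    field_simp at h'
    exact h'
  have h0 : (expMeasure 1) ((fun t : ℝ => Real.exp (-(t / ρ) ^ (1 / α))) ⁻¹' {x} ∩ Ici 0) = 0 := by
    rw [expMeasure, gammaMeasure]
    exact withDensity_absolutelyContinuous _ _ (hs.measure_zero _)
  rw [← h0]
  apply measure_congr
  filter_upwards [expMeasure_ae_nonneg] with t ht
  apply propext
  exact ⟨fun h => ⟨h, ht⟩, fun h => h.1⟩

/-- Concavity of t ↦ (t/ρ)^(1/α): the right side is its tangent at L. For L = log n the slope is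
s_n, which is how s_n enters the first moment. -/
lemma div_rpow_le_tangent (hρ : 0 < ρ) (hα : 1 ≤ α) {L t : ℝ} (hL : 0 < L) (ht : 0 ≤ t) :
    (t / ρ) ^ (1 / α) ≤ (L / ρ) ^ (1 / α) + (L / ρ) ^ (1 / α) / α / L * (t - L) := by
  have h1 : (t / ρ) ^ (1 / α) = (L / ρ) ^ (1 / α) * (1 + (t / L - 1)) ^ (1 / α) := by
    rw [← Real.mul_rpow (by positivity) (by simp; positivity)]
    congr 1
    field_simp
    ring
  have h3 : (1 + (t / L - 1)) ^ (1 / α) ≤ 1 + (1 / α) * (t / L - 1) :=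
    rpow_one_add_le_one_add_mul_self (by linarith [show 0 ≤ t / L by positivity]) (by positivity)
      ((div_le_one (by linarith)).2 hα)
  have hM : 0 < (L / ρ) ^ (1 / α) := by positivity
  rw [h1]
  calc _ ≤ (L / ρ) ^ (1 / α) * (1 + (1 / α) * (t / L - 1)) := by gcongr
    _ = _ := by field_simp

/-- Negative moments of the edge weights at the scale of their `e ^ (-L)`-quantile. -/
lemma lintegral_rpow_edgeLaw_le (hρ : 0 < ρ) (hα : 1 ≤ α) {L q : ℝ} (hL : 0 < L) (hq0 : 0 ≤ q)
    (hq : q < 1) :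
    ∫⁻ x, ENNReal.ofReal ((x / Real.exp (-(L / ρ) ^ (1 / α))) ^
        (-(q / ((L / ρ) ^ (1 / α) / α / L)))) ∂(edgeLaw ρ α) ≤
      ENNReal.ofReal (Real.exp (-(q * L)) / (1 - q)) := by
  have hq' : 0 < 1 - q := by linarith
  rw [edgeLaw, lintegral_map (by fun_prop) measurable_edgeMap]
  have hM : 0 < (L / ρ) ^ (1 / α) := by positivity
  set M := (L / ρ) ^ (1 / α) with hMdef
  have hα0 : 0 < α := by linarith
  -- In terms of E the power is exp((q/s)((E/ρ)^(1/α) - M)) with s = M/α/L; the tangent bound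
  -- replaces the exponent by q(E - L), leaving an exponential moment of order q < 1.
  calc _ ≤ ∫⁻ t, ENNReal.ofReal (Real.exp (-(q * L))) * ENNReal.ofReal (Real.exp (q * t))
          ∂(expMeasure 1) := by
        apply lintegral_mono_ae
        filter_upwards [expMeasure_ae_nonneg] with t ht
        rw [← ENNReal.ofReal_mul (by positivity)]
        apply ENNReal.ofReal_le_ofReal
        rw [← Real.exp_sub, ← Real.exp_mul, ← Real.exp_add, Real.exp_le_exp]
        have h := div_rpow_le_tangent hρ hα hL ht
        rw [← hMdef] at h
        have hs : 0 < M / α / L := by positivity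
        calc _ = (q / (M / α / L)) * ((t / ρ) ^ (1 / α) - M) := by ring
          _ ≤ (q / (M / α / L)) * (M / α / L * (t - L)) := by gcongr; linarith
          _ = _ := by field_simp; ring
    _ = _ := by
        rw [lintegral_const_mul _ (by fun_prop), lintegral_exp_mul_expMeasure hq,
          ← ENNReal.ofReal_mul (by positivity), mul_one_div]

end EdgeLaw

/-! ### Counting and encoding self-avoiding paths. -/

section Paths

variable {V : Type*} {G : SimpleGraph V}

/-- A path is determined by its ends and its set of edges. -/
lemma isPath_eq_of_edges {a b : V} {p q : G.Walk a b} (hp : p.IsPath) (hq : q.IsPath)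
    (h : ∀ e, e ∈ p.edges ↔ e ∈ q.edges) : p = q := by
  induction p with
  | nil => exact (SimpleGraph.Walk.eq_nil_iff_nil.2 (SimpleGraph.Walk.isPath_iff_nil.1 hq)).symm
  | @cons a c b hac p ih =>
    cases q with
    | nil => exact SimpleGraph.Walk.eq_nil_iff_nil.2 (SimpleGraph.Walk.isPath_iff_nil.1 hp)
    | @cons _ d _ had q =>
      rw [SimpleGraph.Walk.cons_isPath_iff] at hp hq
      simp only [SimpleGraph.Walk.edges_cons, List.mem_cons] at h
      have np : ∀ e ∈ p.edges, a ∉ e := by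
        rintro e he hae
        exact hp.2 (SimpleGraph.Walk.mem_support_of_mem_edges he hae)
      have nq : ∀ e ∈ q.edges, a ∉ e := by
        rintro e he hae
        exact hq.2 (SimpleGraph.Walk.mem_support_of_mem_edges he hae)
      have hcd : c = d := by
        rcases (h s(a, c)).1 (Or.inl rfl) with h1 | h1
        · exact Sym2.congr_right.1 h1
        · exact absurd (Sym2.mem_mk_left a c) (nq _ h1)
      subst hcd
      rw [ih hp.1 hq.1 fun e => ?_]
      constructor
      · intro he
        rcases (h e).1 (Or.inr he) with rfl | h1
        · exact absurd (Sym2.mem_mk_left a c) (np _ he)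
        · exact h1
      · intro he
        rcases (h e).2 (Or.inr he) with rfl | h1
        · exact absurd (Sym2.mem_mk_left a c) (nq _ he)
        · exact h1

/-- The ends are fixed, so the k - 1 interior vertices determine the path. The missing factor n is
the -1 in the exponent L (h log(c/h) - 1). -/
lemma card_paths_length_le [Fintype V] {a b : V} [Fintype (G.Path a b)] {k : ℕ} (hk : 0 < k) :
    (Finset.univ.filter fun p : G.Path a b => p.1.length = k).card ≤ Fintype.card V ^ (k - 1) := by
  classical
  have : Fintype.card V ^ (k - 1) = (Finset.univ : Finset (Fin (k - 1) → V)).card := by simp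
  rw [this]
  apply Finset.card_le_card_of_injOn (fun (p : G.Path a b) (i : Fin (k - 1)) => p.1.getVert (i + 1))
  · intro p _; simp
  · intro p hp q hq hpq
    simp only [Finset.coe_filter, Finset.mem_univ, true_and, Set.mem_ofPred_eq] at hp hq
    apply Subtype.ext
    apply SimpleGraph.Walk.ext_getVert_le_length (by rw [hp, hq])
    intro j hj
    rw [hp] at hj
    rcases Nat.eq_zero_or_pos j with rfl | hj0
    · simp
    · rcases hj.eq_or_lt with rfl | hlt
      · conv_lhs => rw [← hp, SimpleGraph.Walk.getVert_length]
        rw [← hq, SimpleGraph.Walk.getVert_length]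
      · have := congrFun hpq ⟨j - 1, by omega⟩
        simpa [Nat.sub_add_cancel hj0] using this

lemma exists_walk_of_seq (v : ℕ → V) (k : ℕ) (h : ∀ i < k, G.Adj (v i) (v (i + 1))) :
    ∃ p : G.Walk (v 0) (v k), p.support = (List.range (k + 1)).map v ∧
      p.edges = (List.range k).map fun i => s(v i, v (i + 1)) := by
  induction k with
  | zero => exact ⟨.nil, by simp, by simp⟩
  | succ k ih =>
    obtain ⟨p, hp, hp'⟩ := ih fun i hi => h i (by omega)
    refine ⟨p.concat (h k (by omega)), ?_, ?_⟩
    · rw [SimpleGraph.Walk.support_concat, hp, List.range_succ (n := k + 1)]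
      simp
    · rw [SimpleGraph.Walk.edges_concat, hp', List.range_succ (n := k)]
      simp

lemma pathWeight_eq_sum [DecidableEq V] (x : Sym2 V → ℝ) {a b : V} (p : G.Path a b) :
    pathWeight x p = ∑ e ∈ p.1.edges.toFinset, x e := by
  rw [pathWeight, List.sum_toFinset _ p.2.edges_nodup]

lemma card_edges_toFinset [DecidableEq V] {a b : V} (p : G.Path a b) :
    p.1.edges.toFinset.card = p.1.length := by
  rw [List.toFinset_card_of_nodup p.2.edges_nodup, SimpleGraph.Walk.length_edges]

end Paths

/-! ### Product moments and ties in an independent family. -/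

section IndependentFamily

variable {Ω ι : Type*} [MeasurableSpace Ω] {P : Measure Ω} {S : Set ι} {X : ι → Ω → ℝ}
  {μ : Measure ℝ}

lemma lintegral_prod_of_iIndepFun (hind : iIndepFun (fun e : S => X e) P)
    (hlaw : ∀ e ∈ S, HasLaw (X e) μ P) {A : Finset ι} (hA : (A : Set ι) ⊆ S)
    {g : ℝ → ENNReal} (hg : Measurable g) :
    ∫⁻ ω, ∏ e ∈ A, g (X e ω) ∂P = (∫⁻ x, g x ∂μ) ^ A.card := by
  classical
  have aem : ∀ e : S, AEMeasurable (X e) P := fun e => (hlaw e e.2).aemeasurable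
  -- The weights are only almost everywhere measurable, so the product formula is applied to
  -- measurable versions.
  have hind' : iIndepFun (fun e : S => g ∘ (aem e).mk (X e)) P :=
    (hind.congr fun e => (aem e).ae_eq_mk).comp (fun _ => g) fun _ => hg
  have hA' : ∀ e ∈ A, e ∈ S := fun e he => hA he
  have h1 : ∀ ω, ∏ e ∈ A, g (X e ω) = ∏ e ∈ A.subtype (· ∈ S), g (X e ω) := fun ω =>
    (Finset.prod_subtype_of_mem (fun e => g (X e ω)) hA').symm
  have hall : ∀ᵐ ω ∂P, ∀ e ∈ A.subtype (· ∈ S), X e ω = (aem e).mk (X e) ω :=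
    (eventually_all_finset _).2 fun e _ => (aem e).ae_eq_mk
  calc ∫⁻ ω, ∏ e ∈ A, g (X e ω) ∂P
      = ∫⁻ ω, ∏ e ∈ A.subtype (· ∈ S), (g ∘ (aem e).mk (X e)) ω ∂P := by
        apply lintegral_congr_ae
        filter_upwards [hall] with ω hω
        rw [h1]
        exact Finset.prod_congr rfl fun e he => by rw [Function.comp_apply, ← hω e he]
    _ = ∏ e ∈ A.subtype (· ∈ S), ∫⁻ ω, (g ∘ (aem e).mk (X e)) ω ∂P :=
        lintegral_prod_eq_prod_lintegral_of_indepFun _ _ hind'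
          fun e => hg.comp (aem e).measurable_mk
    _ = ∏ e ∈ A.subtype (· ∈ S), ∫⁻ x, g x ∂μ := by
        refine Finset.prod_congr rfl fun e _ => ?_
        rw [← (hlaw e e.2).map_eq, lintegral_map' hg.aemeasurable (aem e)]
        apply lintegral_congr_ae
        filter_upwards [(aem e).ae_eq_mk] with ω hω
        rw [Function.comp_apply, ← hω]
    _ = _ := by
        rw [Finset.prod_const, Finset.card_subtype, Finset.filter_true_of_mem hA']

lemma measure_eq_zero_of_indepFun [IsFiniteMeasure P] {Y Z : Ω → ℝ} (hY : AEMeasurable Y P)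
    (hZ : AEMeasurable Z P) (h : IndepFun Y Z P) (hν : NullSingletonClass (P.map Z)) :
    P {ω | Y ω = Z ω} = 0 := by
  have hmeas : MeasurableSet {x : ℝ × ℝ | x.1 = x.2} :=
    measurableSet_eq_fun measurable_fst measurable_snd
  have h1 : P {ω | Y ω = Z ω} = P.map (fun ω => (Y ω, Z ω)) {x : ℝ × ℝ | x.1 = x.2} := by
    rw [Measure.map_apply_of_aemeasurable (hY.prodMk hZ) hmeas]
    rfl
  rw [h1, (indepFun_iff_map_prod_eq_prod_map_map hY hZ).1 h, Measure.measure_prod_null hmeas]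
  refine ae_of_all _ fun y => ?_
  have : Prod.mk y ⁻¹' {x : ℝ × ℝ | x.1 = x.2} = {y} := by
    ext z; simp [eq_comm]
  change P.map Z (Prod.mk y ⁻¹' {x : ℝ × ℝ | x.1 = x.2}) = 0
  rw [this]
  exact measure_singleton y

/-- A tie determines the weight of an edge in only one of the two sets as a function of the other
weights. That function is independent of it, and an atomless variable almost surely avoids an
independent value. -/
lemma measure_sum_eq_sum_eq_zero [IsFiniteMeasure P] [DecidableEq ι] [NullSingletonClass μ]
    (hind : iIndepFun (fun e : S => X e) P)
    (hlaw : ∀ e ∈ S, HasLaw (X e) μ P) {A B : Finset ι} (hA : (A : Set ι) ⊆ S)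
    (hB : (B : Set ι) ⊆ S) (hAB : A ≠ B) :
    P {ω | ∑ e ∈ A, X e ω = ∑ e ∈ B, X e ω} = 0 := by
  wlog hex : ∃ e ∈ A, e ∉ B generalizing A B
  · have h := this hB hA hAB.symm (by
      by_contra hcon
      push Not at hex hcon
      exact hAB (Finset.Subset.antisymm hex hcon))
    rw [← h]
    congr 1
    ext ω
    exact eq_comm
  obtain ⟨e, heA, heB⟩ := hex
  classical
  have heS : e ∈ S := hA heA
  -- Solving the tie for `X e`, with e in A but not in B, gives coefficients 1_B - 1_A on the other
  -- edges; the value 1 at e keeps `X e` itself in the rescaled family.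
  let d : ι → ℝ := fun j => if j = e then 1 else (if j ∈ B then 1 else 0) - (if j ∈ A then 1 else 0)
  have hind' : iIndepFun (fun j : S => (fun x => d j * x) ∘ X j) P :=
    hind.comp (fun j x => d j * x) fun j => by fun_prop
  have aem : ∀ j : S, AEMeasurable ((fun x => d j * x) ∘ X j) P := fun j =>
    (hlaw j j.2).aemeasurable.const_mul (d j)
  let T := ((A ∪ B).erase e).subtype (· ∈ S)
  have heT : (⟨e, heS⟩ : S) ∉ T := by simp [T]
  have hI := hind'.indepFun_finsetSum_of_notMem₀ aem heT
  have haemY : AEMeasurable (∑ j ∈ T, (fun x => d j * x) ∘ X j) P :=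
    T.aemeasurable_sum fun j _ => aem j
  have hZ : (fun x => d e * x) ∘ X e = X e := by
    funext ω; simp [d]
  have hν : NullSingletonClass (P.map ((fun x => d e * x) ∘ X e)) := by
    rw [hZ, (hlaw e heS).map_eq]; infer_instance
  refine measure_mono_null (fun ω hω => ?_)
    (measure_eq_zero_of_indepFun haemY (aem ⟨e, heS⟩) hI hν)
  have hω' : ∑ j ∈ A, X j ω = ∑ j ∈ B, X j ω := hω
  change (∑ j ∈ T, (fun x => d j * x) ∘ X j) ω = ((fun x => d e * x) ∘ X e) ω
  rw [hZ, Finset.sum_apply]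
  have h1 : ∑ j ∈ T, ((fun x => d j * x) ∘ X j) ω = ∑ j ∈ (A ∪ B).erase e, d j * X j ω :=
    Finset.sum_subtype_of_mem (fun j => d j * X j ω) fun j hj => by
      rcases Finset.mem_union.1 (Finset.mem_of_mem_erase hj) with h | h
      exacts [hA h, hB h]
  have h2 : ∑ j ∈ (A ∪ B).erase e, d j * X j ω = ∑ j ∈ (A ∪ B).erase e,
      ((if j ∈ B then X j ω else 0) - (if j ∈ A then X j ω else 0)) := by
    refine Finset.sum_congr rfl fun j hj => ?_
    simp only [d, if_neg (Finset.ne_of_mem_erase hj)]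
    split_ifs <;> ring
  have h3 := Finset.sum_erase_add (A ∪ B)
    (fun j => (if j ∈ B then X j ω else 0) - (if j ∈ A then X j ω else 0))
    (Finset.mem_union_left B heA)
  have h4 : ∑ j ∈ A ∪ B, ((if j ∈ B then X j ω else 0) - (if j ∈ A then X j ω else 0)) = 0 := by
    rw [Finset.sum_sub_distrib, ← Finset.sum_filter, ← Finset.sum_filter,
      Finset.filter_mem_eq_inter, Finset.filter_mem_eq_inter, Finset.union_inter_cancel_right,
      Finset.union_inter_cancel_left, hω', sub_self]
  rw [h1, h2]
  rw [h4, if_neg heB, if_pos heA] at h3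
  linarith

end IndependentFamily

/-- AM-GM bounds the geometric mean of the x e / u by w / (|A| u). Raised to the power |A| m this is
a pointwise bound of an indicator by a product, suited to independence. -/
lemma one_le_mul_prod_rpow_neg {ι : Type*} {A : Finset ι} (hA : A.Nonempty) {x : ι → ℝ}
    (hx : ∀ e ∈ A, 0 < x e) {w u m : ℝ} (hu : 0 < u) (hm : 0 ≤ m) (hw : ∑ e ∈ A, x e ≤ w) :
    1 ≤ (w / (A.card * u)) ^ (A.card * m) * ∏ e ∈ A, (x e / u) ^ (-m) := by
  have hk : (0 : ℝ) < A.card := by exact_mod_cast hA.card_pos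
  have hz : ∀ e ∈ A, 0 < x e / u := fun e he => div_pos (hx e he) hu
  have h1 := Real.geom_mean_le_arith_mean_weighted A (fun _ => 1 / (A.card : ℝ))
    (fun e => x e / u) (fun _ _ => by positivity) (by simp [hk.ne']) fun e he => (hz e he).le
  have h2 : ∑ e ∈ A, 1 / (A.card : ℝ) * (x e / u) ≤ w / (A.card * u) := by
    rw [← Finset.mul_sum, ← Finset.sum_div]
    calc _ = (∑ e ∈ A, x e) / (A.card * u) := by field_simp
      _ ≤ _ := by gcongr
  have h3 : (∏ e ∈ A, (x e / u) ^ (1 / (A.card : ℝ))) ^ (A.card * m) ≤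
      (w / (A.card * u)) ^ (A.card * m) :=
    Real.rpow_le_rpow (Finset.prod_nonneg fun e he => (Real.rpow_pos_of_pos (hz e he) _).le)
      (h1.trans h2) (by positivity)
  rw [← Real.finsetProd_rpow _ _ fun e he => (Real.rpow_pos_of_pos (hz e he) _).le] at h3
  have h4 : ∏ e ∈ A, ((x e / u) ^ (1 / (A.card : ℝ))) ^ (A.card * m) = ∏ e ∈ A, (x e / u) ^ m :=
    Finset.prod_congr rfl fun e he => by
      rw [← Real.rpow_mul (hz e he).le]; congr 1; field_simp
  rw [h4] at h3
  have h5 : (∏ e ∈ A, (x e / u) ^ m) * ∏ e ∈ A, (x e / u) ^ (-m) = 1 := by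
    rw [← Finset.prod_mul_distrib]
    refine Finset.prod_eq_one fun e he => ?_
    rw [← Real.rpow_add (hz e he), add_neg_cancel, Real.rpow_zero]
  rw [← h5]
  exact mul_le_mul_of_nonneg_right h3
    (Finset.prod_nonneg fun e he => (Real.rpow_pos_of_pos (hz e he) _).le)

/-! ### First moment bounds, and uniqueness of the optimal path. -/

section FirstMoment

variable {Ω : Type*} [MeasurableSpace Ω] {P : Measure Ω} {ρ α : ℝ}

lemma measure_sum_le_le {ι : Type*} {S : Set ι} {X : ι → Ω → ℝ} (hρ : 0 < ρ) (hα : 1 ≤ α)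
    (hind : iIndepFun (fun e : S => X e) P) (hlaw : ∀ e ∈ S, HasLaw (X e) (edgeLaw ρ α) P)
    {A : Finset ι} (hA : (A : Set ι) ⊆ S) (hA0 : A.Nonempty) {L q w : ℝ} (hL : 0 < L)
    (hq0 : 0 ≤ q) (hq : q < 1) (hw : 0 < w) :
    P {ω | ∑ e ∈ A, X e ω ≤ w} ≤ ENNReal.ofReal
      ((w / (A.card * Real.exp (-(L / ρ) ^ (1 / α)))) ^
          (A.card * (q / ((L / ρ) ^ (1 / α) / α / L))) *
        (Real.exp (-(q * L)) / (1 - q)) ^ A.card) := by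
  have hmom := lintegral_rpow_edgeLaw_le hρ hα hL hq0 hq
  set u := Real.exp (-(L / ρ) ^ (1 / α)) with hu
  have hu0 : 0 < u := Real.exp_pos _
  set m := q / ((L / ρ) ^ (1 / α) / α / L) with hmdef
  have hm : 0 ≤ m := by positivity
  have hq' : 0 < 1 - q := by linarith
  set C := (w / (A.card * u)) ^ (A.card * m) with hC
  have hC0 : 0 ≤ C := by positivity
  have hpos : ∀ᵐ ω ∂P, ∀ e ∈ A, 0 < X e ω := by
    refine (eventually_all_finset _).2 fun e he => ?_
    have h := edgeLaw_ae_pos (ρ := ρ) (α := α)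
    rw [← (hlaw e (hA he)).map_eq] at h
    exact ae_of_ae_map (hlaw e (hA he)).aemeasurable h
  have hg : Measurable fun x : ℝ => ENNReal.ofReal ((x / u) ^ (-m)) := by fun_prop
  have haem : AEMeasurable (fun ω => ∏ e ∈ A, ENNReal.ofReal ((X e ω / u) ^ (-m))) P :=
    Finset.aemeasurable_fun_prod _ fun e he =>
      hg.comp_aemeasurable (hlaw e (hA he)).aemeasurable
  calc P {ω | ∑ e ∈ A, X e ω ≤ w}
      ≤ P {ω | 1 ≤ ENNReal.ofReal C * ∏ e ∈ A, ENNReal.ofReal ((X e ω / u) ^ (-m))} := by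
        apply measure_mono_ae
        filter_upwards [hpos] with ω hω hsum
        have h := one_le_mul_prod_rpow_neg hA0 hω hu0 hm hsum
        change 1 ≤ ENNReal.ofReal C * ∏ e ∈ A, ENNReal.ofReal ((X e ω / u) ^ (-m))
        rw [← ENNReal.ofReal_prod_of_nonneg
          fun e he => Real.rpow_nonneg (div_nonneg (hω e he).le hu0.le) _,
          ← ENNReal.ofReal_mul hC0]
        exact ENNReal.one_le_ofReal.2 h
    _ ≤ ∫⁻ ω, ENNReal.ofReal C * ∏ e ∈ A, ENNReal.ofReal ((X e ω / u) ^ (-m)) ∂P := by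
        simpa using mul_meas_ge_le_lintegral₀ (haem.const_mul (ENNReal.ofReal C)) 1
    _ = ENNReal.ofReal C * (∫⁻ x, ENNReal.ofReal ((x / u) ^ (-m)) ∂(edgeLaw ρ α)) ^ A.card := by
        rw [lintegral_const_mul'' _ haem]
        congr 1
        exact lintegral_prod_of_iIndepFun hind hlaw hA hg
    _ ≤ ENNReal.ofReal C * (ENNReal.ofReal (Real.exp (-(q * L)) / (1 - q))) ^ A.card := by
        gcongr
    _ = _ := by
        rw [← ENNReal.ofReal_pow (by positivity), ← ENNReal.ofReal_mul hC0]

lemma coe_edges_toFinset_subset {V : Type*} [DecidableEq V] {G : SimpleGraph V} {a b : V}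
    (p : G.Path a b) : ((p.1.edges.toFinset : Finset (Sym2 V)) : Set (Sym2 V)) ⊆ G.edgeSet := by
  intro e he
  exact p.1.edges_subset_edgeSet (by simpa using he)

/-- First moment bound for light paths whose length lies in a prescribed set. -/
lemma measure_exists_path_le {V : Type*} [Fintype V] {G : SimpleGraph V} {a b : V}
    (hab : a ≠ b) {X : Sym2 V → Ω → ℝ} (hρ : 0 < ρ) (hα : 1 ≤ α)
    (hind : iIndepFun (fun e : G.edgeSet => X e) P)
    (hlaw : ∀ e ∈ G.edgeSet, HasLaw (X e) (edgeLaw ρ α) P) {L q w r : ℝ} (hL : 0 < L)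
    (hq0 : 0 ≤ q) (hq : q < 1) (hw : 0 < w) (K : Set ℕ) (hr0 : 0 ≤ r) (hr : r < 1)
    (hK : ∀ k ∈ K, 0 < k → (Fintype.card V : ℝ) ^ (k - 1) *
      ((w / (k * Real.exp (-(L / ρ) ^ (1 / α)))) ^ (k * (q / ((L / ρ) ^ (1 / α) / α / L))) *
        (Real.exp (-(q * L)) / (1 - q)) ^ k) ≤ r ^ k) :
    P {ω | ∃ p : G.Path a b, p.1.length ∈ K ∧ pathWeight (fun e => X e ω) p ≤ w} ≤
      ENNReal.ofReal (r / (1 - r)) := by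
  classical
  let E : ℕ → Set Ω := fun k =>
    {ω | ∃ p : G.Path a b, p.1.length = k ∧ k ∈ K ∧ pathWeight (fun e => X e ω) p ≤ w}
  have hsub : {ω | ∃ p : G.Path a b, p.1.length ∈ K ∧ pathWeight (fun e => X e ω) p ≤ w} ⊆
      ⋃ j, E (j + 1) := by
    rintro ω ⟨p, hp, hpw⟩
    -- Length zero is impossible between distinct ends, so the geometric series starts at the first
    -- power of r.
    have h0 : p.1.length ≠ 0 := fun h => hab (SimpleGraph.Walk.eq_of_length_eq_zero h)
    refine Set.mem_iUnion.2 ⟨p.1.length - 1, p, ?_, ?_, hpw⟩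
    · omega
    · rwa [Nat.sub_add_cancel (by omega)]
  have hE : ∀ j, P (E (j + 1)) ≤ ENNReal.ofReal (r ^ (j + 1)) := by
    intro j
    by_cases hj : j + 1 ∈ K
    swap
    · have : E (j + 1) = ∅ := by
        ext ω; simp [E, hj]
      simp [this]
    let F := Finset.univ.filter fun p : G.Path a b => p.1.length = j + 1
    have hF : F.card ≤ Fintype.card V ^ j := card_paths_length_le (k := j + 1) (by omega)
    have hEF : E (j + 1) ⊆ ⋃ p ∈ F, {ω | ∑ e ∈ p.1.edges.toFinset, X e ω ≤ w} := by
      rintro ω ⟨p, hp, -, hpw⟩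
      refine Set.mem_biUnion (by simpa [F] using hp) ?_
      rw [pathWeight_eq_sum] at hpw
      exact hpw
    refine (measure_mono hEF).trans ((measure_biUnion_finset_le _ _).trans ?_)
    refine le_trans (Finset.sum_le_card_nsmul F _ (ENNReal.ofReal
        ((w / ((j + 1 : ℕ) * Real.exp (-(L / ρ) ^ (1 / α)))) ^
          ((j + 1 : ℕ) * (q / ((L / ρ) ^ (1 / α) / α / L))) *
        (Real.exp (-(q * L)) / (1 - q)) ^ (j + 1))) fun p hp => ?_)
      (le_trans ?_ (ENNReal.ofReal_le_ofReal (hK _ hj (by omega))))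
    · have hlen : p.1.length = j + 1 := by simpa [F] using hp
      have hcard := card_edges_toFinset p
      have := measure_sum_le_le hρ hα hind hlaw (coe_edges_toFinset_subset p)
        (Finset.card_pos.1 (by omega)) hL hq0 hq hw
      rwa [hcard, hlen] at this
    · rw [ENNReal.ofReal_mul (p := (Fintype.card V : ℝ) ^ (j + 1 - 1)) (by positivity),
        nsmul_eq_mul, Nat.add_sub_cancel]
      gcongr
      rw [ENNReal.ofReal_pow (by positivity), ENNReal.ofReal_natCast]
      exact_mod_cast hF
  calc _ ≤ ∑' j, P (E (j + 1)) := (measure_mono hsub).trans (measure_iUnion_le _)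
    _ ≤ ∑' j, ENNReal.ofReal (r ^ (j + 1)) := ENNReal.tsum_le_tsum hE
    _ = _ := by
      have hs : HasSum (fun j : ℕ => r ^ (j + 1)) (r / (1 - r)) := by
        simpa [pow_succ', div_eq_mul_inv] using (hasSum_geometric_of_lt_one hr0 hr).mul_left r
      rw [← ENNReal.ofReal_tsum_of_nonneg (fun j => by positivity) hs.summable, hs.tsum_eq]

lemma ae_existsUnique_isOptimal [IsFiniteMeasure P] {V : Type*} [Finite V] {G : SimpleGraph V}
    {a b : V}
    (hab : G.Reachable a b) {X : Sym2 V → Ω → ℝ} {μ : Measure ℝ} [NullSingletonClass μ]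
    (hind : iIndepFun (fun e : G.edgeSet => X e) P)
    (hlaw : ∀ e ∈ G.edgeSet, HasLaw (X e) μ P) :
    ∀ᵐ ω ∂P, ∃! p : G.Path a b, IsOptimal (fun e => X e ω) p := by
  classical
  have := Fintype.ofFinite V
  have hne : ∀ p q : G.Path a b, p ≠ q →
      ∀ᵐ ω ∂P, pathWeight (fun e => X e ω) p ≠ pathWeight (fun e => X e ω) q := by
    intro p q hpq
    have hAB : p.1.edges.toFinset ≠ q.1.edges.toFinset := fun h =>
      hpq (Subtype.ext (isPath_eq_of_edges p.2 q.2 fun e => by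
        simpa using Finset.ext_iff.1 h e))
    have h := measure_sum_eq_sum_eq_zero hind hlaw (coe_edges_toFinset_subset p)
      (coe_edges_toFinset_subset q) hAB
    rw [ae_iff]
    simpa [pathWeight_eq_sum] using h
  have hall : ∀ᵐ ω ∂P, ∀ p q : G.Path a b, p ≠ q →
      pathWeight (fun e => X e ω) p ≠ pathWeight (fun e => X e ω) q := by
    rw [ae_all_iff]; intro p
    rw [ae_all_iff]; intro q
    by_cases hpq : p = q
    · exact ae_of_all _ fun ω h => absurd hpq h
    · filter_upwards [hne p q hpq] with ω hω _ using hω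
  have hNe : Nonempty (G.Path a b) := by
    obtain ⟨w⟩ := hab
    exact ⟨w.toPath⟩
  filter_upwards [hall] with ω hω
  obtain ⟨p, hp⟩ := Finite.exists_min fun p : G.Path a b => pathWeight (fun e => X e ω) p
  refine ⟨p, hp, fun q hq => ?_⟩
  by_contra hqp
  exact hω q p hqp (le_antisymm (hq p) (hp q))

end FirstMoment

/-! ### The second moment method. -/

section SecondMoment

variable {Ω : Type*} [MeasurableSpace Ω] {P : Measure Ω}

/-- The second moment method for the number of events that occur. -/
lemma measureReal_forall_notMem_le [IsProbabilityMeasure P] {ι : Type*} [Fintype ι]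
    {A : ι → Set Ω} (hA : ∀ i, NullMeasurableSet (A i) P) (hpos : 0 < ∑ i, P.real (A i)) :
    P.real {ω | ∀ i, ω ∉ A i} ≤
      (∑ i, ∑ j, P.real (A i ∩ A j)) / (∑ i, P.real (A i)) ^ 2 - 1 := by
  set c := ∑ i, P.real (A i) with hc
  have hB : NullMeasurableSet {ω | ∀ i, ω ∉ A i} P := by
    have : {ω | ∀ i, ω ∉ A i} = ⋂ i, (A i)ᶜ := by ext; simp
    rw [this]
    exact NullMeasurableSet.iInter fun i => (hA i).compl
  have hint : ∀ S : Set Ω, NullMeasurableSet S P → Integrable (S.indicator (1 : Ω → ℝ)) P :=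
    fun S hS => (integrable_const (1 : ℝ)).indicator₀ hS
  have hval : ∀ S : Set Ω, NullMeasurableSet S P → ∫ ω, S.indicator (1 : Ω → ℝ) ω ∂P = P.real S :=
    fun S hS => by
      have := integral_indicator₀ (μ := P) (f := (1 : Ω → ℝ)) hS
      simpa using this
  have hI1 : Integrable (fun ω => ∑ i, ∑ j, (A i ∩ A j).indicator (1 : Ω → ℝ) ω) P :=
    integrable_finsetSum _ fun i _ => integrable_finsetSum _ fun j _ =>
      hint _ ((hA i).inter (hA j))
  have hI2 : Integrable (fun ω => 2 * c * ∑ i, (A i).indicator (1 : Ω → ℝ) ω) P :=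
    (integrable_finsetSum _ fun i _ => hint _ (hA i)).const_mul _
  have hI3 : Integrable (fun ω => (∑ i, ∑ j, (A i ∩ A j).indicator (1 : Ω → ℝ) ω) -
      2 * c * ∑ i, (A i).indicator (1 : Ω → ℝ) ω) P := hI1.sub hI2
  -- Chebyshev's argument: if N counts the events and c = E N, then c² 1_{N = 0} ≤ (N - c)² = N² -
  -- 2cN + c².
  have key : c ^ 2 * P.real {ω | ∀ i, ω ∉ A i} ≤ (∑ i, ∑ j, P.real (A i ∩ A j)) - c ^ 2 := by
    calc c ^ 2 * P.real {ω | ∀ i, ω ∉ A i}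
        = ∫ ω, c ^ 2 * {ω | ∀ i, ω ∉ A i}.indicator (1 : Ω → ℝ) ω ∂P := by
          rw [integral_const_mul, hval _ hB]
      _ ≤ ∫ ω, ((∑ i, ∑ j, (A i ∩ A j).indicator (1 : Ω → ℝ) ω) -
            2 * c * ∑ i, (A i).indicator (1 : Ω → ℝ) ω + c ^ 2) ∂P := by
          refine integral_mono ((hint _ hB).const_mul _) (hI3.add (integrable_const _))
            fun ω => ?_
          have e1 : ∑ i, ∑ j, (A i ∩ A j).indicator (1 : Ω → ℝ) ω =
              (∑ i, (A i).indicator (1 : Ω → ℝ) ω) * ∑ i, (A i).indicator (1 : Ω → ℝ) ω := by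
            rw [Finset.sum_mul_sum]
            simp_rw [Set.inter_indicator_one, Pi.mul_apply]
          change c ^ 2 * {ω | ∀ i, ω ∉ A i}.indicator (1 : Ω → ℝ) ω ≤
            (∑ i, ∑ j, (A i ∩ A j).indicator (1 : Ω → ℝ) ω) -
            2 * c * ∑ i, (A i).indicator (1 : Ω → ℝ) ω + c ^ 2
          rw [e1]
          by_cases hω : ∀ i, ω ∉ A i
          · have h0 : ∑ i, (A i).indicator (1 : Ω → ℝ) ω = 0 :=
              Finset.sum_eq_zero fun i _ => Set.indicator_of_notMem (hω i) _
            rw [h0, Set.indicator_of_mem (by exact hω)]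
            simp
          · rw [Set.indicator_of_notMem (by exact hω)]
            nlinarith [sq_nonneg ((∑ i, (A i).indicator (1 : Ω → ℝ) ω) - c)]
      _ = (∑ i, ∑ j, P.real (A i ∩ A j)) - 2 * c * c + c ^ 2 := by
          rw [integral_add hI3 (integrable_const _), integral_sub hI1 hI2,
            integral_finsetSum _ fun i _ => integrable_finsetSum _ fun j _ =>
              hint _ ((hA i).inter (hA j)), integral_const_mul,
            integral_finsetSum _ fun i _ => hint _ (hA i)]
          have e1 : ∀ i, ∫ ω, ∑ j, (A i ∩ A j).indicator (1 : Ω → ℝ) ω ∂P =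
              ∑ j, P.real (A i ∩ A j) := fun i => by
            rw [integral_finsetSum _ fun j _ => hint _ ((hA i).inter (hA j))]
            exact Finset.sum_congr rfl fun j _ => hval _ ((hA i).inter (hA j))
          simp_rw [hval _ (hA _), e1, ← hc]
          simp
      _ = _ := by ring
  have hc2 : 0 < c ^ 2 := by positivity
  rw [le_sub_iff_add_le, le_div_iff₀ hc2]
  linarith

lemma measureReal_forall_le_eq {ι : Type*} {S : Set ι} {X : ι → Ω → ℝ} {μ : Measure ℝ}
    (hind : iIndepFun (fun e : S => X e) P)
    (hlaw : ∀ e ∈ S, HasLaw (X e) μ P) {A : Finset ι} (hA : (A : Set ι) ⊆ S) (w : ℝ) :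
    P.real {ω | ∀ e ∈ A, X e ω ≤ w} = μ.real (Set.Iic w) ^ A.card := by
  have hg : Measurable ((Set.Iic w).indicator (1 : ℝ → ENNReal)) :=
    measurable_one.indicator measurableSet_Iic
  have h := lintegral_prod_of_iIndepFun hind hlaw hA hg
  rw [lintegral_indicator_one measurableSet_Iic] at h
  have hnull : NullMeasurableSet {ω | ∀ e ∈ A, X e ω ≤ w} P := by
    have : {ω | ∀ e ∈ A, X e ω ≤ w} = ⋂ e ∈ A, X e ⁻¹' Set.Iic w := by ext; simp
    rw [this]
    exact A.nullMeasurableSet_biInter fun e he =>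
      (hlaw e (hA he)).aemeasurable.nullMeasurable measurableSet_Iic
  have h2 : ∀ ω, ∏ e ∈ A, (Set.Iic w).indicator (1 : ℝ → ENNReal) (X e ω) =
      {ω | ∀ e ∈ A, X e ω ≤ w}.indicator 1 ω := by
    intro ω
    by_cases hω : ∀ e ∈ A, X e ω ≤ w
    · rw [Set.indicator_of_mem (by exact hω)]
      exact Finset.prod_eq_one fun e he => Set.indicator_of_mem (s := Set.Iic w) (hω e he) _
    · rw [Set.indicator_of_notMem (by exact hω)]
      push Not at hω
      obtain ⟨e, he, hew⟩ := hω
      exact Finset.prod_eq_zero he (Set.indicator_of_notMem (by simpa using hew) _)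
  simp_rw [h2] at h
  rw [lintegral_indicator_one₀ hnull] at h
  rw [measureReal_def, h, ENNReal.toReal_pow, measureReal_def]

end SecondMoment

/-! ### Paths through layers, and their overlaps. -/

section Layers

variable {V : Type*} {r m : ℕ}

/-- The vertices of the path from `a` to `b` through `r` layers of `m` vertices that visits the
`f i`-th vertex of layer `i`. -/
def layerSeq (a b : V) (φ : Fin r → Fin m → V) (f : Fin r → Fin m) (i : ℕ) : V :=
  if i = 0 then a else if h : i - 1 < r then φ ⟨i - 1, h⟩ (f ⟨i - 1, h⟩) else b

/-- The edges of the path through the layers that is encoded by `f`. -/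
def layerEdge (a b : V) (φ : Fin r → Fin m → V) (f : Fin r → Fin m) (i : ℕ) : Sym2 V :=
  s(layerSeq a b φ f i, layerSeq a b φ f (i + 1))

/-- The endpoints and the layers are separated by the level function `lev`, and each layer consists
of distinct vertices. -/
structure IsLayering (a b : V) (φ : Fin r → Fin m → V) (lev : V → ℕ) : Prop where
  lev_left : lev a = 0
  lev_right : lev b = r + 1
  lev_layer : ∀ i j, lev (φ i j) = i + 1
  injective : ∀ i, Function.Injective (φ i)

variable {a b : V} {φ : Fin r → Fin m → V} {lev : V → ℕ}

@[simp] lemma layerSeq_zero (f : Fin r → Fin m) : layerSeq a b φ f 0 = a := by simp [layerSeq]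

@[simp] lemma layerSeq_last (f : Fin r → Fin m) : layerSeq a b φ f (r + 1) = b := by
  simp [layerSeq]

lemma layerSeq_succ (f : Fin r → Fin m) (i : Fin r) :
    layerSeq a b φ f (i + 1) = φ i (f i) := by
  simp [layerSeq]

namespace IsLayering

lemma lev_layerSeq (h : IsLayering a b φ lev) (f : Fin r → Fin m) {i : ℕ} (hi : i ≤ r + 1) :
    lev (layerSeq a b φ f i) = i := by
  unfold layerSeq
  split_ifs with h0 h1
  · rw [h.lev_left, h0]
  · rw [h.lev_layer]; simp only; omega
  · rw [h.lev_right]; omega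

lemma layerEdge_eq (h : IsLayering a b φ lev) {f g : Fin r → Fin m} {i j : ℕ} (hi : i < r + 1)
    (hj : j < r + 1) (he : layerEdge a b φ f i = layerEdge a b φ g j) :
    i = j ∧ layerSeq a b φ f i = layerSeq a b φ g i ∧
      layerSeq a b φ f (i + 1) = layerSeq a b φ g (i + 1) := by
  have h1 := h.lev_layerSeq f (i := i) (by omega)
  have h2 := h.lev_layerSeq f (i := i + 1) (by omega)
  have h3 := h.lev_layerSeq g (i := j) (by omega)
  have h4 := h.lev_layerSeq g (i := j + 1) (by omega)
  rcases Sym2.eq_iff.1 he with ⟨e1, e2⟩ | ⟨e1, e2⟩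
  · rw [e1, h3] at h1
    subst h1
    exact ⟨rfl, e1, e2⟩
  -- Levels increase by one along every layered path, so an edge cannot be traversed in the opposite
  -- direction by another.
  · rw [e1, h4] at h1
    rw [e2, h3] at h2
    omega

lemma layerSeq_eq_iff (h : IsLayering a b φ lev) {f g : Fin r → Fin m} (i : Fin r) :
    layerSeq a b φ f (i + 1) = layerSeq a b φ g (i + 1) ↔ f i = g i := by
  rw [layerSeq_succ, layerSeq_succ, (h.injective i).eq_iff]

variable [DecidableEq V]

lemma card_image_layerEdge (h : IsLayering a b φ lev) (f : Fin r → Fin m) :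
    ((Finset.range (r + 1)).image (layerEdge a b φ f)).card = r + 1 := by
  rw [Finset.card_image_of_injOn, Finset.card_range]
  intro i hi j hj hij
  exact (h.layerEdge_eq (by simpa using hi) (by simpa using hj) hij).1

/-- Let the paths differ in layer i₀. A common edge has both ends common, so it misses layer i₀.
Sending it to its end farther from the start if it lies before i₀, and to its end nearer the start
if after, is injective into the common layer vertices: the usual extra edge is lost to i₀. -/
lemma card_inter_layerEdge_le (h : IsLayering a b φ lev) {f g : Fin r → Fin m} (hfg : f ≠ g) :
    ((Finset.range (r + 1)).image (layerEdge a b φ f) ∩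
      (Finset.range (r + 1)).image (layerEdge a b φ g)).card ≤
      (Finset.univ.filter fun i => f i = g i).card := by
  obtain ⟨i₀, hi₀⟩ := Function.ne_iff.1 hfg
  let I := (Finset.range (r + 1)).filter fun i =>
    layerSeq a b φ f i = layerSeq a b φ g i ∧ layerSeq a b φ f (i + 1) = layerSeq a b φ g (i + 1)
  have hI : (Finset.range (r + 1)).image (layerEdge a b φ f) ∩
      (Finset.range (r + 1)).image (layerEdge a b φ g) ⊆ I.image (layerEdge a b φ f) := by
    intro e he
    simp only [Finset.mem_inter, Finset.mem_image, Finset.mem_range] at he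
    obtain ⟨⟨i, hi, rfl⟩, j, hj, hij⟩ := he
    have := h.layerEdge_eq hi hj hij.symm
    exact Finset.mem_image_of_mem _ (by simp only [I, Finset.mem_filter, Finset.mem_range]
                                        exact ⟨hi, this.2⟩)
  refine (Finset.card_le_card hI).trans (Finset.card_image_le.trans ?_)
  have hI0 : ∀ i ∈ I, i ≠ i₀ ∧ i ≠ i₀ + 1 ∧ i < r + 1 := by
    intro i hi
    simp only [I, Finset.mem_filter, Finset.mem_range] at hi
    refine ⟨?_, ?_, hi.1⟩
    · rintro rfl
      exact hi₀ ((h.layerSeq_eq_iff i₀).1 hi.2.2)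
    · rintro rfl
      exact hi₀ ((h.layerSeq_eq_iff i₀).1 hi.2.1)
  have hmap : ∀ i ∈ I, (if i < i₀ then i else i - 1) < r := by
    intro i hi
    have := hI0 i hi
    have := i₀.2
    split_ifs <;> omega
  refine Finset.card_le_card_of_injOn
    (fun i => if hi : (if i < i₀ then i else i - 1) < r then ⟨_, hi⟩ else i₀) ?_ ?_
  · intro i hi
    have h0 := hI0 i hi
    have hi' := hi
    simp only [Finset.mem_coe, I, Finset.mem_filter, Finset.mem_range] at hi
    simp only [dif_pos (hmap i hi'), Finset.coe_filter, Finset.mem_univ, true_and,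
      Set.mem_ofPred_eq]
    rw [← h.layerSeq_eq_iff]
    simp only
    split_ifs with hlt
    · exact hi.2.2
    · rw [Nat.sub_add_cancel (by omega)]
      exact hi.2.1
  · intro i hi j hj hij
    simp only [dif_pos (hmap i hi), dif_pos (hmap j hj), Fin.mk.injEq] at hij
    have h1 := hI0 i hi
    have h2 := hI0 j hj
    split_ifs at hij <;> omega

end IsLayering

variable {Ω : Type*} [MeasurableSpace Ω] {P : Measure Ω}

lemma layerEdge_mem_edgeSet (h : IsLayering a b φ lev) (f : Fin r → Fin m) {i : ℕ}
    (hi : i < r + 1) : layerEdge a b φ f i ∈ (⊤ : SimpleGraph V).edgeSet := by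
  rw [layerEdge, SimpleGraph.mem_edgeSet, SimpleGraph.top_adj]
  intro he
  have h1 := h.lev_layerSeq f (i := i) (by omega)
  have h2 := h.lev_layerSeq f (i := i + 1) (by omega)
  rw [he, h2] at h1
  omega

/-- The diagonal of the second moment contributes the inverse mean. Off the diagonal each common
vertex costs at most a factor 1/p, and the sum over the second path factorises over layers. -/
lemma measureReal_forall_exists_layerEdge_le [IsProbabilityMeasure P]
    (h : IsLayering a b φ lev) {X : Sym2 V → Ω → ℝ} {μ : Measure ℝ} [IsProbabilityMeasure μ]
    (hind : iIndepFun (fun e : (⊤ : SimpleGraph V).edgeSet => X e) P)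
    (hlaw : ∀ e ∈ (⊤ : SimpleGraph V).edgeSet, HasLaw (X e) μ P) {w p : ℝ}
    (hpw : μ.real (Set.Iic w) = p) (hp : 0 < p) (hm : 0 < m) :
    P.real {ω | ∀ f : Fin r → Fin m, ∃ i < r + 1, w < X (layerEdge a b φ f i) ω} ≤
      (m ^ r * p ^ (r + 1))⁻¹ + (1 + (m * p)⁻¹) ^ r - 1 := by
  classical
  have hp1 : p ≤ 1 := hpw ▸ measureReal_le_one
  have hm' : (0 : ℝ) < m := by exact_mod_cast hm
  let E : (Fin r → Fin m) → Finset (Sym2 V) := fun f =>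
    (Finset.range (r + 1)).image (layerEdge a b φ f)
  have hE : ∀ f, (E f : Set (Sym2 V)) ⊆ (⊤ : SimpleGraph V).edgeSet := by
    intro f e he
    simp only [E, Finset.coe_image, Finset.coe_range, Set.mem_image, Set.mem_Iio] at he
    obtain ⟨i, hi, rfl⟩ := he
    exact layerEdge_mem_edgeSet h f hi
  let A : (Fin r → Fin m) → Set Ω := fun f => {ω | ∀ e ∈ E f, X e ω ≤ w}
  have hA : ∀ f, NullMeasurableSet (A f) P := by
    intro f
    have : A f = ⋂ e ∈ E f, X e ⁻¹' Set.Iic w := by ext; simp [A]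
    rw [this]
    exact (E f).nullMeasurableSet_biInter fun e he =>
      (hlaw e (hE f he)).aemeasurable.nullMeasurable measurableSet_Iic
  have hPA : ∀ f, P.real (A f) = p ^ (r + 1) := by
    intro f
    rw [measureReal_forall_le_eq hind hlaw (hE f) w, hpw, h.card_image_layerEdge]
  have hPAA : ∀ f g, P.real (A f ∩ A g) ≤ (if f = g then p ^ (r + 1) else 0) +
      p ^ (2 * (r + 1)) * ∏ i, (if f i = g i then p⁻¹ else 1) := by
    intro f g
    have hprod : 0 ≤ p ^ (2 * (r + 1)) * ∏ i, (if f i = g i then p⁻¹ else 1) :=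
      mul_nonneg (by positivity) (Finset.prod_nonneg fun i _ => by split_ifs <;> positivity)
    by_cases hfg : f = g
    · subst hfg
      rw [Set.inter_self, hPA, if_pos rfl]
      linarith
    · rw [if_neg hfg, zero_add]
      have hU : A f ∩ A g = {ω | ∀ e ∈ E f ∪ E g, X e ω ≤ w} := by
        ext ω
        simp only [A, Set.mem_inter_iff, Set.mem_ofPred_eq, Finset.mem_union]
        exact ⟨fun hω e he => he.elim (hω.1 e) (hω.2 e),
          fun hω => ⟨fun e he => hω e (Or.inl he), fun e he => hω e (Or.inr he)⟩⟩
      rw [hU, measureReal_forall_le_eq hind hlaw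
        (by rw [Finset.coe_union]; exact Set.union_subset (hE f) (hE g)) w, hpw]
      have h1 := Finset.card_union_add_card_inter (E f) (E g)
      have h2 : (E f ∩ E g).card ≤ _ := h.card_inter_layerEdge_le hfg
      have h3 : (E f).card = r + 1 := h.card_image_layerEdge f
      have h4 : (E g).card = r + 1 := h.card_image_layerEdge g
      rw [Finset.prod_ite, Finset.prod_const, Finset.prod_const_one, mul_one]
      -- The union has 2(r+1) - |E f ∩ E g| edges and the overlap is at most J; since p ≤ 1, its
      -- probability is at most p^(2(r+1)) p^(-J).
      set J := (Finset.univ.filter fun i => f i = g i).card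
      have h5 : p ^ (2 * (r + 1)) = p ^ (E f ∪ E g).card * p ^ (E f ∩ E g).card := by
        rw [← pow_add, h1, h3, h4, two_mul]
      have h6 : p ^ J ≤ p ^ (E f ∩ E g).card := pow_le_pow_of_le_one hp.le hp1 h2
      have h7 : p ^ J * p⁻¹ ^ J = 1 := by
        rw [← mul_pow, mul_inv_cancel₀ hp.ne', one_pow]
      calc p ^ (E f ∪ E g).card = p ^ (E f ∪ E g).card * (p ^ J * p⁻¹ ^ J) := by rw [h7, mul_one]
        _ ≤ p ^ (E f ∪ E g).card * (p ^ (E f ∩ E g).card * p⁻¹ ^ J) := by gcongr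
        _ = _ := by rw [h5]; ring
  have hsum : ∑ f, P.real (A f) = m ^ r * p ^ (r + 1) := by
    simp [hPA]
  have hinner : ∀ f : Fin r → Fin m, ∑ g : Fin r → Fin m,
      ∏ i, (if f i = g i then p⁻¹ else (1 : ℝ)) = (m - 1 + p⁻¹) ^ r := by
    intro f
    have h1 := Finset.prod_univ_sum (fun _ : Fin r => (Finset.univ : Finset (Fin m)))
      fun i j => if f i = j then p⁻¹ else (1 : ℝ)
    rw [Fintype.piFinset_univ] at h1
    rw [← h1]
    have h2 : ∀ i : Fin r, ∑ j, (if f i = j then p⁻¹ else (1 : ℝ)) = m - 1 + p⁻¹ := by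
      intro i
      have : ∀ j, (if f i = j then p⁻¹ else (1 : ℝ)) = (if f i = j then p⁻¹ - 1 else 0) + 1 := by
        intro j; split_ifs <;> ring
      simp_rw [this]
      rw [Finset.sum_add_distrib, Finset.sum_ite_eq]
      simp
      ring
    simp_rw [h2]
    simp
  have hdouble : ∑ f, ∑ g, P.real (A f ∩ A g) ≤
      m ^ r * p ^ (r + 1) + p ^ (2 * (r + 1)) * m ^ r * (m - 1 + p⁻¹) ^ r := by
    calc _ ≤ ∑ f : Fin r → Fin m, ∑ g : Fin r → Fin m, ((if f = g then p ^ (r + 1) else 0) +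
          p ^ (2 * (r + 1)) * ∏ i, (if f i = g i then p⁻¹ else 1)) :=
          Finset.sum_le_sum fun f _ => Finset.sum_le_sum fun g _ => hPAA f g
      _ = ∑ f : Fin r → Fin m, (p ^ (r + 1) + p ^ (2 * (r + 1)) * (m - 1 + p⁻¹) ^ r) := by
          refine Finset.sum_congr rfl fun f _ => ?_
          rw [Finset.sum_add_distrib, ← Finset.mul_sum, hinner, Finset.sum_ite_eq,
            if_pos (Finset.mem_univ _)]
      _ = _ := by
          rw [Finset.sum_const]
          simp
          ring
  have hmain := measureReal_forall_notMem_le hA (by rw [hsum]; positivity)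
  rw [hsum] at hmain
  have hset : {ω | ∀ f : Fin r → Fin m, ∃ i < r + 1, w < X (layerEdge a b φ f i) ω} =
      {ω | ∀ f, ω ∉ A f} := by
    ext ω
    simp [A, E]
  rw [hset]
  refine hmain.trans (sub_le_sub_right ?_ 1)
  rw [div_le_iff₀ (by positivity)]
  refine hdouble.trans ?_
  have e1 : (m - 1 + p⁻¹ : ℝ) ≤ m * (1 + (m * p)⁻¹) := by
    have : (m : ℝ) * (1 + (m * p)⁻¹) = m + p⁻¹ := by field_simp
    rw [this]; linarith
  have e2 : (m - 1 + p⁻¹ : ℝ) ^ r ≤ m ^ r * (1 + (m * p)⁻¹) ^ r := by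
    rw [← mul_pow]
    have : (1 : ℝ) ≤ m := by exact_mod_cast hm
    have hpi : 0 < p⁻¹ := by positivity
    exact pow_le_pow_left₀ (by linarith) e1 r
  calc (m : ℝ) ^ r * p ^ (r + 1) + p ^ (2 * (r + 1)) * m ^ r * (m - 1 + p⁻¹) ^ r
      ≤ m ^ r * p ^ (r + 1) + p ^ (2 * (r + 1)) * m ^ r * (m ^ r * (1 + (m * p)⁻¹) ^ r) := by
        gcongr
    _ = _ := by field_simp; ring

lemma exists_path_of_layerEdge_le (h : IsLayering a b φ lev) {x : Sym2 V → ℝ} {w : ℝ}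
    {f : Fin r → Fin m} (hf : ∀ i < r + 1, x (layerEdge a b φ f i) ≤ w) :
    ∃ p : (⊤ : SimpleGraph V).Path a b, pathWeight x p ≤ (r + 1) * w := by
  obtain ⟨p, hp, hp'⟩ := exists_walk_of_seq (G := ⊤) (layerSeq a b φ f) (r + 1)
    fun i hi => layerEdge_mem_edgeSet h f hi
  have hnodup : p.IsPath := by
    rw [SimpleGraph.Walk.isPath_def, hp]
    refine List.Nodup.map_on (fun i hi j hj hij => ?_) List.nodup_range
    have h1 := h.lev_layerSeq f (i := i) (by simpa [Nat.lt_succ_iff] using hi)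
    have h2 := h.lev_layerSeq f (i := j) (by simpa [Nat.lt_succ_iff] using hj)
    rw [← h1, ← h2, hij]
  have key : ((p.edges.map x).sum) ≤ (r + 1) * w := by
    rw [hp', List.map_map]
    refine (List.sum_le_card_nsmul _ w fun y hy => ?_).trans_eq (by simp)
    simp only [List.mem_map, List.mem_range, Function.comp_apply] at hy
    obtain ⟨i, hi, rfl⟩ := hy
    exact hf i hi
  refine ⟨⟨p.copy (layerSeq_zero f) (layerSeq_last f), by simpa using hnodup⟩, ?_⟩
  rw [pathWeight]
  simpa using key

end Layers

/-- The asymptotic number of edges of the optimal path, as a function of `L = log n`. -/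
noncomputable def hopScale (ρ α L : ℝ) : ℝ := (L / ρ) ^ (1 / α) / α

/-! ### Asymptotics of the scales. -/

section Scales

variable {ρ α : ℝ}

lemma hopScale_pos (hρ : 0 < ρ) (hα : 0 < α) {L : ℝ} (hL : 0 < L) : 0 < hopScale ρ α L := by
  unfold hopScale; positivity

lemma sSeq_mul_log (hρ : 0 < ρ) (hα : 0 < α) {n : ℕ} (hn : 2 ≤ n) :
    sSeq ρ α n * Real.log n = hopScale ρ α (Real.log n) := by
  have hL : 0 < Real.log n := Real.log_pos (by exact_mod_cast hn)
  rw [sSeq, hopScale, Real.rpow_add hL, Real.rpow_neg_one, Real.div_rpow hL.le hρ.le]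
  field_simp

lemma tendsto_hopScale (hρ : 0 < ρ) (hα : 0 < α) : Tendsto (hopScale ρ α) atTop atTop := by
  unfold hopScale
  exact ((tendsto_rpow_atTop (by positivity)).comp (tendsto_id.atTop_div_const hρ)).atTop_div_const
    hα

lemma hopScale_eq (hρ : 0 < ρ) {L : ℝ} (hL : 0 < L) :
    hopScale ρ α L = L ^ (1 / α) * (ρ ^ (1 / α) * α)⁻¹ := by
  rw [hopScale, Real.div_rpow hL.le hρ.le]
  field_simp

/-- Here `hopScale ρ α L / L` is s_n at L = log n, of order L^(1/α - 1). The factor 1 + log L is the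
cost per edge of taking q = 1 - 1/L in the negative moment. -/
lemma tendsto_hopScale_div_mul_log (hρ : 0 < ρ) (hα : 1 < α) :
    Tendsto (fun L => hopScale ρ α L / L * (1 + Real.log L)) atTop (𝓝 0) := by
  have hα0 : 0 < α := by linarith
  have hb : 0 < 1 - 1 / α := by
    have : 1 / α < 1 := by rw [div_lt_one hα0]; exact hα
    linarith
  have h1 : Tendsto (fun L : ℝ => L ^ (-(1 - 1 / α))) atTop (𝓝 0) := tendsto_rpow_neg_atTop hb
  have h2 : Tendsto (fun L : ℝ => Real.log L / L ^ (1 - 1 / α)) atTop (𝓝 0) :=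
    (isLittleO_log_rpow_atTop hb).tendsto_div_nhds_zero
  have h3 := ((h1.add h2).const_mul (ρ ^ (1 / α) * α)⁻¹)
  rw [add_zero, mul_zero] at h3
  refine h3.congr' ?_
  filter_upwards [eventually_gt_atTop 0] with L hL
  rw [hopScale_eq hρ hL, Real.rpow_neg hL.le, Real.rpow_sub hL, Real.rpow_one]
  have : (0 : ℝ) < L ^ (1 / α) := by positivity
  field_simp

lemma tendsto_hopScale_div (hρ : 0 < ρ) (hα : 1 < α) :
    Tendsto (fun L => hopScale ρ α L / L) atTop (𝓝 0) := by
  refine squeeze_zero' ?_ ?_ (tendsto_hopScale_div_mul_log hρ hα)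
  · filter_upwards [eventually_gt_atTop 0] with L hL
    exact (div_pos (hopScale_pos hρ (by linarith) hL) hL).le
  · filter_upwards [eventually_ge_atTop 1] with L hL
    have h := (div_pos (hopScale_pos hρ (α := α) (by linarith) (by linarith : 0 < L))
      (by linarith)).le
    have := Real.log_nonneg hL
    nlinarith

lemma tendsto_log_natCast : Tendsto (fun n : ℕ => Real.log n) atTop atTop :=
  Real.tendsto_log_atTop.comp tendsto_natCast_atTop_atTop

end Scales

/-! ### The rate function h log(c/h) - 1. -/

section RateFunction

/-- From log(1/h) ≤ 1/h - 1. For c < e the coefficient of h is negative, which rules out all lengths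
at once; the 3 matches the ζ of `first_moment_term_le`. -/
lemma mul_log_div_le {c h : ℝ} (hc : 0 < c) (hh : 0 < h) :
    h * Real.log (c / h) ≤ 1 - 3 * ((1 - Real.log c) / 3) * h := by
  have h1 := Real.log_le_sub_one_of_pos (inv_pos.2 hh)
  rw [div_eq_mul_inv, Real.log_mul hc.ne' (inv_pos.2 hh).ne']
  calc h * (Real.log c + Real.log h⁻¹) ≤ h * (Real.log c + (h⁻¹ - 1)) := by gcongr
    _ = _ := by field_simp; ring

/-- With y = 1/h, the gap y - 1 - log y is convex and vanishes only at y = 1, so it is bounded below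
when h stays away from 1. Half of the bound pays for raising c from e to e^(1+η). -/
lemma exists_mul_log_div_le {ε : ℝ} (hε : 0 < ε) : ∃ η > 0, ∀ h > 0, ε ≤ |h - 1| →
    h * Real.log (Real.exp (1 + η) / h) ≤ 1 - 3 * (η / 3) * h := by
  wlog hε1 : ε < 1 generalizing ε
  · obtain ⟨η, hη, H⟩ := this (ε := 1 / 2) (by norm_num) (by norm_num)
    exact ⟨η, hη, fun h hh hεh => H h hh (by linarith)⟩
  have h1 := Real.log_lt_sub_one_of_pos (x := (1 + ε)⁻¹) (by positivity)
    (by rw [Ne, inv_eq_one]; linarith)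
  have h2 := Real.log_lt_sub_one_of_pos (x := (1 - ε)⁻¹) (inv_pos.2 (by linarith))
    (by rw [Ne, inv_eq_one]; linarith)
  set y₁ := (1 + ε)⁻¹ with hy₁
  set y₂ := (1 - ε)⁻¹ with hy₂
  have hy₁0 : 0 < y₁ := by positivity
  have hy₂0 : 0 < y₂ := inv_pos.2 (by linarith)
  have hy₁1 : y₁ ≤ 1 := inv_le_one_of_one_le₀ (by linarith)
  have hy₂1 : 1 ≤ y₂ := (one_le_inv₀ (by linarith)).2 (by linarith)
  let η := min (y₁ - 1 - Real.log y₁) (y₂ - 1 - Real.log y₂) / 2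
  have hη : 0 < η := half_pos (lt_min (by linarith) (by linarith))
  refine ⟨η, hη, fun h hh hεh => ?_⟩
  have key : 2 * η ≤ h⁻¹ - 1 - Real.log h⁻¹ := by
    have hyy : 0 < h⁻¹ := inv_pos.2 hh
    rcases le_abs.1 hεh with hge | hle
    · have hy : h⁻¹ ≤ y₁ := inv_anti₀ (by linarith) (by linarith)
      have hl := Real.log_le_sub_one_of_pos (div_pos hyy hy₁0)
      rw [Real.log_div hyy.ne' hy₁0.ne'] at hl
      have : h⁻¹ / y₁ - 1 ≤ h⁻¹ - y₁ := by
        rw [div_sub_one hy₁0.ne', div_le_iff₀ hy₁0]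
        nlinarith
      have := min_le_left (y₁ - 1 - Real.log y₁) (y₂ - 1 - Real.log y₂)
      simp only [η]
      linarith
    · have hy : y₂ ≤ h⁻¹ := inv_anti₀ hh (by linarith)
      have hl := Real.log_le_sub_one_of_pos (div_pos hyy hy₂0)
      rw [Real.log_div hyy.ne' hy₂0.ne'] at hl
      have : h⁻¹ / y₂ - 1 ≤ h⁻¹ - y₂ := by
        rw [div_sub_one hy₂0.ne', div_le_iff₀ hy₂0]
        nlinarith
      have := min_le_right (y₁ - 1 - Real.log y₁) (y₂ - 1 - Real.log y₂)
      simp only [η]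
      linarith
  rw [div_eq_mul_inv, Real.log_mul (Real.exp_ne_zero _) (inv_pos.2 hh).ne', Real.log_exp]
  calc h * (1 + η + Real.log h⁻¹) ≤ h * (1 + η + (h⁻¹ - 1 - 2 * η)) := by gcongr; linarith
    _ = _ := by field_simp; ring

/-- The exponent in the first moment bound is negative, linearly in the number of edges. -/
lemma first_moment_term_le {n k : ℕ} (hk : 0 < k) {L κ c ζ : ℝ} (hn : (n : ℝ) = Real.exp L)
    (hL : 2 ≤ L) (hκ : 0 < κ) (hc : 0 < c) (hζ : 0 < ζ) (hδ : κ / L * (1 + Real.log L) ≤ ζ / 2)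
    (hrate : (k / κ) * Real.log (c / (k / κ)) ≤ 1 - 3 * ζ * (k / κ)) :
    (n : ℝ) ^ (k - 1) * ((c * κ / k) ^ (k * ((1 - 1 / L) / (κ / L))) *
      (Real.exp (-((1 - 1 / L) * L)) / (1 - (1 - 1 / L))) ^ k) ≤ Real.exp (-ζ / (κ / L)) ^ k := by
  have hL0 : 0 < L := by linarith
  have hk' : (0 : ℝ) < k := by exact_mod_cast hk
  have hx : 0 < c * κ / k := by positivity
  have e1 : (n : ℝ) ^ (k - 1) = Real.exp ((k - 1) * L) := by
    rw [hn, ← Real.exp_nat_mul, Nat.cast_sub hk, Nat.cast_one]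
  have e2 : (c * κ / k) ^ (k * ((1 - 1 / L) / (κ / L))) =
      Real.exp (Real.log (c * κ / k) * (k * ((1 - 1 / L) / (κ / L)))) :=
    Real.rpow_def_of_pos hx _
  -- The choice q = 1 - 1/L turns the moment bound into L e^(1-L): only a factor eL above 1/n.
  have e3 : (Real.exp (-((1 - 1 / L) * L)) / (1 - (1 - 1 / L))) ^ k =
      Real.exp (k * (1 - L + Real.log L)) := by
    rw [Real.exp_nat_mul, Real.exp_add, Real.exp_log hL0]
    congr 1
    have : -((1 - 1 / L) * L) = 1 - L := by field_simp; ring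
    rw [this]
    field_simp
    ring
  rw [e1, e2, e3, ← Real.exp_add, ← Real.exp_add, ← Real.exp_nat_mul, Real.exp_le_exp]
  set h := (k : ℝ) / κ with hh
  have hh0 : 0 < h := by positivity
  have e4 : c * κ / k = c / h := by rw [hh]; field_simp
  rw [e4]
  have e5 : (k : ℝ) = h * κ := by rw [hh]; field_simp
  rw [e5]
  have hq1 : 1 - 1 / L ≤ 1 := by
    have : 0 < 1 / L := by positivity
    linarith
  have hq2 : 1 / 2 ≤ 1 - 1 / L := by
    have : 1 / L ≤ 1 / 2 := one_div_le_one_div_of_le (by norm_num) hL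
    linarith
  set q := 1 - 1 / L with hq
  have e6 : (h * κ - 1) * L + (Real.log (c / h) * (h * κ * (q / (κ / L))) +
      h * κ * (1 - L + Real.log L)) =
      L * (-1 + h * (κ / L * (1 + Real.log L)) + q * (h * Real.log (c / h))) := by
    field_simp
    ring
  have e7 : h * κ * (-ζ / (κ / L)) = L * (-ζ * h) := by field_simp
  rw [e6, e7]
  refine mul_le_mul_of_nonneg_left ?_ hL0.le
  -- The budget 3ζh is spent here: q ≥ 1/2 keeps 3ζh/2 of it, the logarithmic error takes ζh/2, and
  -- ζh remains; the constant part is -1 + q ≤ 0.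
  have i1 : h * (κ / L * (1 + Real.log L)) ≤ h * (ζ / 2) := by gcongr
  have i2 : q * (h * Real.log (c / h)) ≤ q * (1 - 3 * ζ * h) := by gcongr
  have hζh : 0 < ζ * h := by positivity
  nlinarith

end RateFunction

/-! ### Absence of paths that are too light for their length. -/

section LightPaths

variable {Ω : Type*} [MeasurableSpace Ω] {P : Measure Ω} {ρ α : ℝ}
  {X : (n : ℕ) → Sym2 (Fin n) → Ω → ℝ}

/-- There are no paths of weight at most `c` times the scale whose length, in units of the hopcount
scale, is in a set where the rate function is negative. -/
lemma tendsto_measure_exists_light_path (hρ : 0 < ρ) (hα : 1 < α)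
    (hlaw : ∀ n, ∀ e ∈ (⊤ : SimpleGraph (Fin n)).edgeSet, HasLaw (X n e) (edgeLaw ρ α) P)
    (hindep : ∀ n, iIndepFun (fun (e : (⊤ : SimpleGraph (Fin n)).edgeSet) => X n e) P)
    {c ζ : ℝ} (hc : 0 < c) (hζ : 0 < ζ) {B : Set ℝ}
    (hB : ∀ h ∈ B, 0 < h → h * Real.log (c / h) ≤ 1 - 3 * ζ * h) :
    Tendsto (fun n : ℕ => P {ω | ∃ hn : 2 ≤ n, ∃ p : MarkedPath hn,
      (p.1.length : ℝ) / hopScale ρ α (Real.log n) ∈ B ∧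
      pathWeight (fun e => X n e ω) p ≤ c * (uSeq ρ α n * hopScale ρ α (Real.log n))})
      atTop (𝓝 0) := by
  have hr : Tendsto (fun L => Real.exp (-ζ / (hopScale ρ α L / L))) atTop (𝓝 0) := by
    have h1 : Tendsto (fun L => hopScale ρ α L / L) atTop (𝓝[>] 0) := by
      refine tendsto_nhdsWithin_iff.2 ⟨tendsto_hopScale_div hρ hα, ?_⟩
      filter_upwards [eventually_gt_atTop 0] with L hL
      exact div_pos (hopScale_pos hρ (by linarith) hL) hL
    refine Real.tendsto_exp_atBot.comp ?_
    simp_rw [div_eq_mul_inv (-ζ)]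
    exact (tendsto_inv_nhdsGT_zero.comp h1).const_mul_atTop_of_neg (by linarith)
  have hlim : Tendsto (fun L => ENNReal.ofReal (Real.exp (-ζ / (hopScale ρ α L / L)) /
      (1 - Real.exp (-ζ / (hopScale ρ α L / L))))) atTop (𝓝 0) := by
    have := hr.div (hr.const_sub 1) (by norm_num)
    simpa using ENNReal.tendsto_ofReal this
  refine tendsto_of_tendsto_of_tendsto_of_le_of_le' tendsto_const_nhds
    (hlim.comp tendsto_log_natCast) (Eventually.of_forall fun _ => zero_le) ?_
  have hδ := (tendsto_hopScale_div_mul_log hρ hα).eventually (Iic_mem_nhds (half_pos hζ))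
  filter_upwards [tendsto_log_natCast.eventually hδ,
    tendsto_log_natCast.eventually (eventually_ge_atTop 2), eventually_ge_atTop 2] with n hδn hL hn
  have hL0 : 0 < Real.log n := by linarith
  have hκ := hopScale_pos hρ (by linarith : 0 < α) hL0
  have hu : 0 < uSeq ρ α n := Real.exp_pos _
  have hs : 0 < hopScale ρ α (Real.log n) / Real.log n := by positivity
  have hq : 1 / Real.log n ≤ 1 / 2 := one_div_le_one_div_of_le (by norm_num) hL
  have hq' : 0 < 1 / Real.log n := by positivity
  have hmain := measure_exists_path_le (a := vertexOne hn) (b := vertexTwo hn)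
    (by simp [vertexOne, vertexTwo]) hρ hα.le (hindep n) (hlaw n) (L := Real.log n)
    (q := 1 - 1 / Real.log n) (w := c * (uSeq ρ α n * hopScale ρ α (Real.log n)))
    (r := Real.exp (-ζ / (hopScale ρ α (Real.log n) / Real.log n))) hL0 (by linarith)
    (by linarith) (by positivity)
    {k : ℕ | (k : ℝ) / hopScale ρ α (Real.log n) ∈ B} (Real.exp_pos _).le
    (by rw [Real.exp_lt_one_iff, neg_div, neg_lt_zero]; positivity) ?_
  · refine (measure_mono ?_).trans hmain
    rintro ω ⟨_, p, hp⟩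
    exact ⟨p, hp⟩
  · intro k hk hk0
    have hk' : (0 : ℝ) < k := by exact_mod_cast hk0
    have := first_moment_term_le (n := n) hk0 (Real.exp_log (by positivity)).symm hL hκ hc hζ hδn
      (hB _ hk (by positivity))
    have e : c * (uSeq ρ α n * hopScale ρ α (Real.log n)) /
        (k * Real.exp (-(Real.log n / ρ) ^ (1 / α))) = c * hopScale ρ α (Real.log n) / k := by
      rw [uSeq]; field_simp
    rw [Fintype.card_fin, e]
    exact this

end LightPaths

/-! ### Layers in the complete graph. -/

section Layering

/-- The layers of the complete graph used in the second moment argument. -/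
def finLayer {n r m : ℕ} (h : 2 + r * m ≤ n) (i : Fin r) (j : Fin m) : Fin n :=
  ⟨2 + (i * m + j), by
    have h1 : (i + 1 : ℕ) * m ≤ r * m := Nat.mul_le_mul_right m i.2
    have h2 := j.2
    rw [Nat.succ_mul] at h1
    omega⟩

lemma isLayering_finLayer {n r m : ℕ} (hn : 2 ≤ n) (h : 2 + r * m ≤ n) :
    IsLayering (vertexOne hn) (vertexTwo hn) (finLayer h)
      fun v => if v.1 = 0 then 0 else if v.1 = 1 then r + 1 else (v.1 - 2) / m + 1 where
  lev_left := by simp [vertexOne]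
  lev_right := by simp [vertexTwo]
  lev_layer i j := by
    have hm : 0 < m := j.pos
    have hv : (finLayer h i j).1 = 2 + (i * m + j) := rfl
    rw [if_neg (by omega), if_neg (by omega), hv, Nat.add_sub_cancel_left, mul_comm,
      Nat.mul_add_div hm, Nat.div_eq_of_lt j.2, Nat.add_zero]
  injective i j j' hjj' := by
    simp only [finLayer, Fin.mk.injEq] at hjj'
    exact Fin.ext (by omega)

end Layering

lemma eventually_one_sub_rpow_le {α β : ℝ} (hα : 0 < α) (hβ : β < 1) :
    ∀ᶠ y in 𝓝[>] (0 : ℝ), (1 - y) ^ α ≤ 1 - α * β * y := by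
  have hd : HasDerivAt (fun y : ℝ => (1 - y) ^ α) (-α) 0 := by
    have h := ((hasDerivAt_id (0 : ℝ)).const_sub 1).rpow_const (p := α) (Or.inl (by simp))
    simpa using h
  have hs := hd.tendsto_slope_zero_right
  have hlt : -α < -(α * β) := by nlinarith
  filter_upwards [hs.eventually (gt_mem_nhds hlt), self_mem_nhdsWithin] with y hy hy0
  have hy0' : 0 < y := hy0
  simp only [zero_add, sub_zero, Real.one_rpow, smul_eq_mul] at hy
  rw [inv_mul_lt_iff₀ hy0'] at hy
  linarith

/-! ### Existence of light paths by the second moment. -/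

section HeavyPaths

variable {ρ α : ℝ}

/-- With M = (L/ρ)^(1/α), -log F(e^(1+θ) u) = L (1 - (1+θ)/M)^α, which is L - (1+θ)/s to first order
for s = M/(αL). Lowering θ to θ/2 absorbs the remainder. -/
lemma eventually_le_cdf (hρ : 0 < ρ) (hα : 1 < α) {θ : ℝ} (hθ : 0 < θ) :
    ∀ᶠ L in atTop, Real.exp (-L + (1 + θ / 2) / (hopScale ρ α L / L)) ≤
      (edgeLaw ρ α).real (Set.Iic (Real.exp (1 + θ) * Real.exp (-(L / ρ) ^ (1 / α)))) := by
  have hα0 : 0 < α := by linarith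
  have hM : Tendsto (fun L => (L / ρ) ^ (1 / α)) atTop atTop :=
    (tendsto_rpow_atTop (by positivity)).comp (tendsto_id.atTop_div_const hρ)
  have hy : Tendsto (fun L => (1 + θ) / (L / ρ) ^ (1 / α)) atTop (𝓝[>] 0) := by
    refine tendsto_nhdsWithin_iff.2 ⟨hM.const_div_atTop _, ?_⟩
    filter_upwards [hM.eventually_gt_atTop 0] with L hL
    exact div_pos (by linarith) hL
  have hβ : (1 + θ / 2) / (1 + θ) < 1 := by
    rw [div_lt_one (by linarith)]; linarith
  filter_upwards [hy.eventually (eventually_one_sub_rpow_le hα0 hβ),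
    hM.eventually_ge_atTop (1 + θ), eventually_gt_atTop 0] with L h1 h2 hL
  have hM0 : 0 < (L / ρ) ^ (1 / α) := by positivity
  have hMα : ρ * ((L / ρ) ^ (1 / α)) ^ α = L := by
    rw [← Real.rpow_mul (by positivity), one_div_mul_cancel hα0.ne', Real.rpow_one]
    field_simp
  rw [hopScale]
  set M := (L / ρ) ^ (1 / α) with hMdef
  have hle : Real.exp (1 + θ) * Real.exp (-M) ≤ 1 := by
    rw [← Real.exp_add, Real.exp_le_one_iff]; linarith
  rw [← cdf_eq_real, cdf_edgeLaw_of_le_one hρ hα0 (by positivity) hle, Real.exp_le_exp,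
    ← Real.exp_add, Real.log_exp]
  have hfac : -(1 + θ + -M) = M * (1 - (1 + θ) / M) := by field_simp; ring
  have hnn : 0 ≤ 1 - (1 + θ) / M := by
    rw [sub_nonneg, div_le_one hM0]; exact h2
  rw [hfac, Real.mul_rpow hM0.le hnn, ← mul_assoc, hMα]
  have h3 : L * (1 - (1 + θ) / M) ^ α ≤ L * (1 - α * ((1 + θ / 2) / (1 + θ)) * ((1 + θ) / M)) := by
    gcongr
  have h4 : L * (1 - α * ((1 + θ / 2) / (1 + θ)) * ((1 + θ) / M)) =
      L - (1 + θ / 2) / (M / α / L) := by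
    field_simp
  linarith

/-- Quantitative conditions under which the expected number of open paths is large. -/
lemma second_moment_bound_le {L κ θ p : ℝ} {n r m : ℕ} (hn : (n : ℝ) = Real.exp L) (hL : 1 ≤ L)
    (hθ : 0 < θ) (hκ1 : 1 ≤ κ) (hκL : κ / L ≤ 1 / 4)
    (hδ : κ / L * (1 + Real.log L) ≤ min (1 / 2) (θ / 8))
    (hr : r = ⌈κ⌉₊) (hm : m = (n - 2) / r)
    (hp : Real.exp (-L + (1 + θ / 2) / (κ / L)) ≤ p) :
    0 < m ∧ ((m : ℝ) ^ r * p ^ (r + 1))⁻¹ + (1 + (m * p)⁻¹) ^ r - 1 ≤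
      Real.exp (-(θ / 4 * L)) + Real.exp (2 / L) - 1 := by
  have hL0 : 0 < L := by linarith
  have hκ0 : 0 < κ := by linarith
  have hlogL := Real.log_nonneg hL
  have hs : 0 < κ / L := by positivity
  have hp0 : 0 < p := (Real.exp_pos _).trans_le hp
  have hrκ : κ ≤ r := hr ▸ Nat.le_ceil κ
  have hr2 : (r : ℝ) ≤ 2 * κ := by
    have := Nat.ceil_lt_add_one hκ0.le
    rw [hr]; linarith
  have hr0 : (0 : ℝ) < r := by linarith
  have hκL' : 4 * κ ≤ L := by
    rw [div_le_iff₀ hL0] at hκL; linarith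
  -- lower bounds for `1 / s`
  have hinv1 : 2 * (1 + Real.log L) ≤ 1 / (κ / L) := by
    rw [le_div_iff₀ hs]
    linarith [hδ.trans (min_le_left _ _)]
  have hinv2 : 2 * (1 + Real.log L) ≤ θ / 4 / (κ / L) := by
    rw [le_div_iff₀ hs]
    linarith [hδ.trans (min_le_right _ _)]
  have hexp2 : L ^ 2 ≤ Real.exp (2 * (1 + Real.log L)) := by
    have : Real.exp (2 * (1 + Real.log L)) = Real.exp 2 * L ^ 2 := by
      rw [mul_add, Real.exp_add, mul_one]
      congr 1
      rw [two_mul, Real.exp_add, Real.exp_log hL0, sq]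
    rw [this]
    have : 1 ≤ Real.exp 2 := Real.one_le_exp (by norm_num)
    nlinarith [sq_nonneg L]
  have hLL : L ≤ L ^ 2 := by nlinarith
  have h4κ : 2 * r ≤ Real.exp (θ / 4 / (κ / L)) := by
    have := Real.exp_le_exp.2 hinv2
    linarith
  -- the layers are large
  have hnr : 2 * (r : ℝ) + 4 ≤ n := by
    have h1 : L + L ^ 2 / 2 + 1 ≤ Real.exp L := by
      have := Real.quadratic_le_exp_of_nonneg hL0.le
      linarith
    rw [hn]
    nlinarith
  have hnr' : r + 2 ≤ n := by
    have : ((r + 2 : ℕ) : ℝ) ≤ n := by push_cast; linarith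
    exact_mod_cast this
  have hr0' : 0 < r := by exact_mod_cast hr0
  have hm1 : (n : ℝ) / (2 * r) ≤ m := by
    have h1 : n - 2 < (m + 1) * r := by
      rw [hm]
      exact (Nat.div_lt_iff_lt_mul hr0').1 (Nat.lt_succ_self _)
    have h2 : (n : ℝ) < (m + 1) * r + 2 := by
      have : n < (m + 1) * r + 2 := by omega
      exact_mod_cast this
    rw [div_le_iff₀ (by positivity)]
    nlinarith
  have hn0 : (0 : ℝ) < n := by rw [hn]; exact Real.exp_pos _
  have hm0 : (0 : ℝ) < m := lt_of_lt_of_le (by positivity) hm1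
  refine ⟨by exact_mod_cast hm0, ?_⟩
  -- the mean number of open edges to the next layer
  have hQ : Real.exp ((1 + θ / 4) / (κ / L)) ≤ m * p := by
    have e1 : Real.exp ((1 + θ / 4) / (κ / L)) * Real.exp (θ / 4 / (κ / L)) =
        n * Real.exp (-L + (1 + θ / 2) / (κ / L)) := by
      rw [hn, ← Real.exp_add, ← Real.exp_add]
      congr 1
      field_simp
      ring
    calc Real.exp ((1 + θ / 4) / (κ / L))
        = n * Real.exp (-L + (1 + θ / 2) / (κ / L)) / Real.exp (θ / 4 / (κ / L)) := by
          rw [← e1]; field_simp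
      _ ≤ n * p / (2 * r) := by gcongr
      _ = n / (2 * r) * p := by ring
      _ ≤ m * p := by gcongr
  have hQ0 : 0 < m * p := by positivity
  have hp' : Real.exp (-L) ≤ p := by
    refine le_trans (Real.exp_le_exp.2 ?_) hp
    have : 0 < (1 + θ / 2) / (κ / L) := by positivity
    linarith
  -- Since κ / (κ/L) = L, the r ≥ κ factors `m * p` give at least e^((1+θ/4)L), and the one edge
  -- beyond the number of layers costs at most e^(-L).
  have hmean : Real.exp (θ / 4 * L) ≤ (m : ℝ) ^ r * p ^ (r + 1) := by
    calc Real.exp (θ / 4 * L) = Real.exp (κ * ((1 + θ / 4) / (κ / L))) * Real.exp (-L) := by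
          rw [← Real.exp_add]; congr 1; field_simp; ring
      _ ≤ Real.exp (r * ((1 + θ / 4) / (κ / L))) * Real.exp (-L) := by gcongr
      _ ≤ (m * p) ^ r * p := by
          rw [Real.exp_nat_mul]; gcongr
      _ = _ := by rw [mul_pow]; ring
  have hfirst : ((m : ℝ) ^ r * p ^ (r + 1))⁻¹ ≤ Real.exp (-(θ / 4 * L)) := by
    rw [Real.exp_neg]
    exact inv_anti₀ (Real.exp_pos _) hmean
  have hQL : L ^ 2 ≤ m * p := by
    refine hexp2.trans ((Real.exp_le_exp.2 (hinv1.trans ?_)).trans hQ)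
    gcongr
    linarith
  have hsecond : (1 + (m * p)⁻¹) ^ r ≤ Real.exp (2 / L) := by
    calc (1 + (m * p)⁻¹) ^ r ≤ Real.exp ((m * p)⁻¹) ^ r := by
          gcongr
          linarith [Real.add_one_le_exp ((m * p)⁻¹)]
      _ = Real.exp (r * (m * p)⁻¹) := by rw [Real.exp_nat_mul]
      _ ≤ Real.exp (2 / L) := by
          rw [Real.exp_le_exp]
          calc r * (m * p)⁻¹ ≤ (2 * L) * (L ^ 2)⁻¹ := by
                gcongr
                linarith
            _ = 2 / L := by field_simp
  linarith

variable {Ω : Type*} [MeasurableSpace Ω] {P : Measure Ω} [IsProbabilityMeasure P]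
  {X : (n : ℕ) → Sym2 (Fin n) → Ω → ℝ}

/-- A layered path with all edges at most e^(1+θ) u_n weighs at most (⌈κ⌉ + 1) e^(1+θ) u_n, and ⌈κ⌉
+ 1 ≤ e^θ κ eventually. Hence c is split as e^(1+2θ). -/
lemma tendsto_measure_forall_heavy_path (hρ : 0 < ρ) (hα : 1 < α)
    (hlaw : ∀ n, ∀ e ∈ (⊤ : SimpleGraph (Fin n)).edgeSet, HasLaw (X n e) (edgeLaw ρ α) P)
    (hindep : ∀ n, iIndepFun (fun (e : (⊤ : SimpleGraph (Fin n)).edgeSet) => X n e) P)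
    {c : ℝ} (hc : Real.exp 1 < c) :
    Tendsto (fun n : ℕ => P {ω | ∃ hn : 2 ≤ n, ∀ p : MarkedPath hn,
      c * (uSeq ρ α n * hopScale ρ α (Real.log n)) < pathWeight (fun e => X n e ω) p})
      atTop (𝓝 0) := by
  have hα0 : 0 < α := by linarith
  have hc0 : 0 < c := (Real.exp_pos 1).trans hc
  obtain ⟨θ, hθ, hcθ⟩ : ∃ θ > 0, Real.exp (1 + 2 * θ) = c := by
    refine ⟨(Real.log c - 1) / 2, ?_, ?_⟩
    · have := (Real.lt_log_iff_exp_lt hc0).2 hc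
      linarith
    · rw [show 1 + 2 * ((Real.log c - 1) / 2) = Real.log c by ring, Real.exp_log hc0]
  have hlim : Tendsto (fun L : ℝ => ENNReal.ofReal
      (Real.exp (-(θ / 4 * L)) + Real.exp (2 / L) - 1)) atTop (𝓝 0) := by
    have h1 : Tendsto (fun L : ℝ => Real.exp (-(θ / 4 * L))) atTop (𝓝 0) :=
      Real.tendsto_exp_atBot.comp (tendsto_neg_atTop_atBot.comp
        (tendsto_id.const_mul_atTop (by positivity)))
    have h2 : Tendsto (fun L : ℝ => Real.exp (2 / L)) atTop (𝓝 1) := by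
      have := (Real.continuous_exp.tendsto 0).comp
        ((tendsto_id (α := ℝ)).const_div_atTop 2)
      simpa [Function.comp_def] using this
    simpa using ENNReal.tendsto_ofReal ((h1.add h2).sub_const 1)
  refine tendsto_of_tendsto_of_tendsto_of_le_of_le' tendsto_const_nhds
    (hlim.comp tendsto_log_natCast) (Eventually.of_forall fun _ => zero_le) ?_
  have hκ := tendsto_hopScale (ρ := ρ) (α := α) hρ hα0
  have hE : ∀ᶠ L in atTop, 1 ≤ L ∧ 1 ≤ hopScale ρ α L ∧ hopScale ρ α L / L ≤ 1 / 4 ∧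
      hopScale ρ α L / L * (1 + Real.log L) ≤ min (1 / 2) (θ / 8) ∧
      2 / (Real.exp θ - 1) ≤ hopScale ρ α L := by
    refine (eventually_ge_atTop 1).and ((hκ.eventually_ge_atTop 1).and
      (((tendsto_hopScale_div hρ hα).eventually (Iic_mem_nhds (by norm_num))).and
      (((tendsto_hopScale_div_mul_log hρ hα).eventually (Iic_mem_nhds ?_)).and
      (hκ.eventually_ge_atTop _))))
    exact lt_min (by norm_num) (by positivity)
  filter_upwards [tendsto_log_natCast.eventually hE,
    tendsto_log_natCast.eventually (eventually_le_cdf hρ hα hθ), eventually_ge_atTop 2]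
    with n ⟨hL, hκ1, hκL, hδ, hκθ⟩ hp hn
  have hn0 : (0 : ℝ) < n := by positivity
  set κ := hopScale ρ α (Real.log n) with hκdef
  have hu : 0 < uSeq ρ α n := Real.exp_pos _
  obtain ⟨hm0, hbound⟩ := second_moment_bound_le (Real.exp_log hn0).symm hL hθ hκ1 hκL hδ rfl rfl hp
  set r := ⌈κ⌉₊ with hr
  have hlay : 2 + r * ((n - 2) / r) ≤ n := by
    have := Nat.mul_div_le (n - 2) r
    omega
  have hl := isLayering_finLayer hn hlay
  set w := Real.exp (1 + θ) * uSeq ρ α n with hw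
  have hpw : 0 < (edgeLaw ρ α).real (Set.Iic w) := (Real.exp_pos _).trans_le hp
  have hmain := measureReal_forall_exists_layerEdge_le hl (hindep n) (hlaw n) (w := w) rfl hpw hm0
  have hweight : (r + 1) * w ≤ c * (uSeq ρ α n * κ) := by
    have h1 : (r : ℝ) + 1 ≤ κ + 2 := by
      have := Nat.ceil_lt_add_one (by linarith : 0 ≤ κ)
      linarith
    have h2 : κ + 2 ≤ Real.exp θ * κ := by
      have : 0 < Real.exp θ - 1 := by
        have := Real.add_one_le_exp θ
        linarith
      rw [div_le_iff₀ this] at hκθ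
      linarith
    have h3 : c = Real.exp (1 + θ) * Real.exp θ := by
      rw [← hcθ, ← Real.exp_add]; congr 1; ring
    calc (r + 1) * w ≤ (Real.exp θ * κ) * w := by
          gcongr
          exact h1.trans h2
      _ = _ := by rw [h3, hw]; ring
  refine (measure_mono ?_).trans ((ENNReal.le_ofReal_iff_toReal_le (measure_ne_top _ _)
    (le_trans measureReal_nonneg (hmain.trans hbound))).2 (hmain.trans hbound))
  rintro ω ⟨_, hω⟩ f
  by_contra hcon
  push Not at hcon
  obtain ⟨p, hp⟩ := exists_path_of_layerEdge_le hl (x := fun e => X n e ω) hcon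
  exact absurd (hp.trans hweight) (not_le.2 (hω p))

end HeavyPaths

/-! ### Optimal paths, and the theorem. -/

section Optimal

lemma exists_isOptimal {n : ℕ} (hn : 2 ≤ n) (x : Sym2 (Fin n) → ℝ) :
    ∃ p : MarkedPath hn, IsOptimal x p := by
  have : Nonempty (MarkedPath hn) := by
    have hadj : (⊤ : SimpleGraph (Fin n)).Adj (vertexOne hn) (vertexTwo hn) := by
      simp [vertexOne, vertexTwo]
    exact ⟨hadj.toWalk.toPath⟩
  exact Finite.exists_min fun p : MarkedPath hn => pathWeight x p

lemma optimalWeight_eq {n : ℕ} {hn : 2 ≤ n} {x : Sym2 (Fin n) → ℝ} {p : MarkedPath hn}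
    (hp : IsOptimal x p) : optimalWeight n x = pathWeight x p := by
  have : Nonempty (MarkedPath hn) := ⟨p⟩
  rw [optimalWeight, dif_pos hn]
  exact le_antisymm (ciInf_le (Set.finite_range _).bddBelow p) (le_ciInf hp)

lemma exists_isOptimal_hopcount_eq {n : ℕ} (hn : 2 ≤ n) (x : Sym2 (Fin n) → ℝ) :
    ∃ p : MarkedPath hn, IsOptimal x p ∧ hopcount n x = p.1.length := by
  obtain ⟨p, hp⟩ := exists_isOptimal hn x
  have hne : {k : ℕ | ∃ p : MarkedPath hn, IsOptimal x p ∧ p.1.length = k}.Nonempty :=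
    ⟨_, p, hp, rfl⟩
  obtain ⟨q, hq, hk⟩ := Nat.sInf_mem hne
  refine ⟨q, hq, ?_⟩
  rw [hopcount, dif_pos hn, hk]

end Optimal

end CompleteFPP

theorem theorem1p2 {Ω : Type*} [MeasurableSpace Ω] (P : Measure Ω) [IsProbabilityMeasure P]
    (ρ α : ℝ) (hρ : 0 < ρ) (hα : 2 < α)
    (X : (n : ℕ) → Sym2 (Fin n) → Ω → ℝ)
    (hlaw : ∀ n, ∀ e ∈ (⊤ : SimpleGraph (Fin n)).edgeSet,
      HasLaw (X n e) (CompleteFPP.edgeLaw ρ α) P)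
    (hindep : ∀ n, iIndepFun (fun (e : (⊤ : SimpleGraph (Fin n)).edgeSet) => X n e) P) :
    (∀ n : ℕ, 2 ≤ n → ∀ u : ℝ,
      CompleteFPP.IsExtremeScale (CompleteFPP.edgeLaw ρ α) n u ↔ u = CompleteFPP.uSeq ρ α n) ∧
    (∀ (n : ℕ) (hn : 2 ≤ n), ∀ᵐ ω ∂P,
      ∃! p : CompleteFPP.MarkedPath hn, CompleteFPP.IsOptimal (fun e => X n e ω) p) ∧
    TendstoInMeasure P
      (fun (n : ℕ) ω => CompleteFPP.optimalWeight n (fun e => X n e ω) /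
        (CompleteFPP.uSeq ρ α n * CompleteFPP.sSeq ρ α n * Real.log n))
      atTop (fun _ => Real.exp 1) ∧
    TendstoInMeasure P
      (fun (n : ℕ) ω => (CompleteFPP.hopcount n (fun e => X n e ω) : ℝ) /
        (CompleteFPP.sSeq ρ α n * Real.log n))
      atTop (fun _ => (1 : ℝ)) := by
  open CompleteFPP in
  have hα0 : 0 < α := by linarith
  have hα1 : 1 < α := by linarith
  refine ⟨fun n hn u => isExtremeScale_edgeLaw_iff hρ hα0 hn u, fun n hn => ?_, ?_, ?_⟩
  · have := nullSingletonClass_edgeLaw hρ hα0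
    obtain ⟨p, -⟩ := exists_isOptimal hn fun _ => 0
    exact ae_existsUnique_isOptimal ⟨p.1⟩ (hindep n) (hlaw n)
  · rw [tendstoInMeasure_iff_dist]
    intro ε hε
    -- Truncation keeps e - ε' positive, as the first moment bound requires.
    let ε' := min ε 1
    have hε' : 0 < ε' := lt_min hε one_pos
    have hε'1 : ε' ≤ 1 := min_le_right _ _
    have he : 2 < Real.exp 1 := by linarith [Real.exp_one_gt_d9]
    have hlow : Real.log (Real.exp 1 - ε') < 1 :=
      (Real.log_lt_iff_lt_exp (by linarith)).2 (by linarith)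
    have h1 := tendsto_measure_exists_light_path hρ hα1 hlaw hindep
      (c := Real.exp 1 - ε') (ζ := (1 - Real.log (Real.exp 1 - ε')) / 3) (by linarith)
      (by linarith) (B := Set.univ) fun h _ hh => mul_log_div_le (by linarith) hh
    have h2 := tendsto_measure_forall_heavy_path hρ hα1 hlaw hindep
      -- Halving ε' leaves room for the strict inequality in the heavy-path event.
      (c := Real.exp 1 + ε' / 2) (by linarith)
    have h3 := h1.add h2
    rw [add_zero] at h3
    refine tendsto_of_tendsto_of_tendsto_of_le_of_le' tendsto_const_nhds h3
      (Eventually.of_forall fun _ => zero_le) ?_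
    filter_upwards [eventually_ge_atTop 2] with n hn
    refine (measure_mono ?_).trans (measure_union_le _ _)
    intro ω hω
    obtain ⟨p, hp⟩ := exists_isOptimal hn fun e => X n e ω
    have hκ := hopScale_pos hρ hα0 (Real.log_pos (by exact_mod_cast hn : (1 : ℝ) < n))
    have hu : 0 < uSeq ρ α n := Real.exp_pos _
    have hD : 0 < uSeq ρ α n * hopScale ρ α (Real.log n) := by positivity
    have hω' : ε ≤ dist (optimalWeight n (fun e => X n e ω) /
      (uSeq ρ α n * sSeq ρ α n * Real.log n)) (Real.exp 1) := hω
    rw [mul_assoc, sSeq_mul_log hρ hα0 hn, optimalWeight_eq hp, Real.dist_eq] at hω'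
    have hεε : ε' ≤ ε := min_le_left _ _
    rcases le_abs.1 hω' with h | h
    · right
      refine ⟨hn, fun q => lt_of_lt_of_le ?_ (hp q)⟩
      rw [← lt_div_iff₀ hD]
      linarith
    · left
      refine ⟨hn, p, Set.mem_univ _, ?_⟩
      rw [← div_le_iff₀ hD]
      linarith
  · rw [tendstoInMeasure_iff_dist]
    intro ε hε
    obtain ⟨η, hη, hrate⟩ := exists_mul_log_div_le hε
    have h1 := tendsto_measure_exists_light_path hρ hα1 hlaw hindep (Real.exp_pos (1 + η))
      (by positivity : 0 < η / 3) (B := {h | ε ≤ |h - 1|}) fun h hB hh => hrate h hh hB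
    have h2 := tendsto_measure_forall_heavy_path hρ hα1 hlaw hindep
      (c := Real.exp (1 + η)) (by rw [Real.exp_lt_exp]; linarith)
    have h3 := h1.add h2
    rw [add_zero] at h3
    refine tendsto_of_tendsto_of_tendsto_of_le_of_le' tendsto_const_nhds h3
      (Eventually.of_forall fun _ => zero_le) ?_
    filter_upwards [eventually_ge_atTop 2] with n hn
    refine (measure_mono ?_).trans (measure_union_le _ _)
    intro ω hω
    obtain ⟨p, hp, hlen⟩ := exists_isOptimal_hopcount_eq hn fun e => X n e ω
    have hω' : ε ≤ dist ((hopcount n (fun e => X n e ω) : ℝ) /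
      (sSeq ρ α n * Real.log n)) 1 := hω
    rw [sSeq_mul_log hρ hα0 hn, hlen, Real.dist_eq] at hω'
    -- Either the optimal path is light with an atypical length, or it is heavy and then so is every
    -- path.
    rcases le_or_gt (pathWeight (fun e => X n e ω) p)
      (Real.exp (1 + η) * (uSeq ρ α n * hopScale ρ α (Real.log n))) with h | h
    · exact Or.inl ⟨hn, p, hω', h⟩
    · exact Or.inr ⟨hn, fun q => h.trans_le (hp q)⟩
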